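/- Notation. Let $d\in\mathbb{N}_0$ and let $\mathcal P(\mathbb{R}^d)$ be the Borel probability measures on $\mathbb{R}^d$, $\mathcal P_2(\mathbb{R}^d)$ those with finite second moment. Let $U(\mu,\nu)$ be the set of couplings of $\mu,\nu$, $\mathcal W^2(\mu,\nu)=\inf_{\Pi\in U(\mu,\nu)}\int|x-y|^2\,d\Pi\in[0,\infty]$, and $U_o(\mu,\nu)$ the set of couplings that minimize $\int|x-y|^2\,d\Pi$. Let $$\mathrm{Bar}(\mu,\nu)=\operatorname*{argmin}_{\rho\in\mathcal P(\mathbb{R}^d)}\ \tfrac12\mathcal W^2(\rho,\mu)+\tfrac12\mathcal W^2(\rho,\nu)$$ be the set of barycenters, and let the set of generalized barycenters $\mathrm{Bar}_{\mu_2}(\mu_1,\mu_3)$ consist of all $(\tfrac12\pi^1+\tfrac12\pi^3)_\#\Pi$, where $\Pi\in\mathcal P((\mathbb{R}^d)^3)$ satisfies $(\pi^1,\pi^2)_\#\Pi\in U_o(\mu_1,\mu_2)$ and $(\pi^2,\pi^3)_\#\Pi\in U_o(\mu_2,\mu_3)$. For a set $S$ of measures let $\mathcal W^2(\mu,S)=\inf_{\beta\in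 S}\mathcal W^2(\mu,\beta)$ (with $\inf\emptyset=\infty$). For a tuple $\boldsymbol\mu=(\mu_0,\dots,\mu_K)$ of probability measures and $\delta>0$ put $$\mathbf E^K(\boldsymbol\mu)=K\sum_{k=0}^{K-1}\mathcal W^2(\mu_k,\mu_{k+1}),$$ $$\mathbf F^K(\boldsymbol\mu)=4K^3\sum_{k=1}^{K-1}\mathcal W^2\big(\mu_k,\mathrm{Bar}(\mu_{k-1},\mu_{k+1})\big),\qquad \mathbf F_G^K(\boldsymbol\mu)=4K^3\sum_{k=1}^{K-1}\mathcal W^2\big(\mu_k,\mathrm{Bar}_{\mu_k}(\mu_{k-1},\mu_{k+1})\big),$$ $$\mathbf F^{\delta,K}=\mathbf F^K+\delta\mathbf E^K,\qquad \mathbf F_G^{\delta,K}=\mathbf F_G^K+\delta\mathbf E^K .$$ Theorem. Let $\delta>0$ and let $2\le I\le K$ be integers. Let $0\le\bar t_1<\dots<\bar t_I\le1$ with $K\bar t_i\in\mathbb{N}_0$, and let $\bar\mu_1,\dots,\bar\mu_I\in\mathcal P_2(\mathbb{R}^d)$. Consider the tuples $(\mu_0,\dots,\mu_K)$ in $\mathcal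 P(\mathbb{R}^d)$ that satisfy $\mu_{K\bar t_i}=\bar\mu_i$ for $i=1,\dots,I$, together with one of the following boundary conditions: - natural: no additional condition; - Hermite: $\mu_0=a_0$, $\mu_1=a_1$, $\mu_{K-1}=b_1$, $\mu_K=b_0$ for given measures $a_0,a_1,b_1,b_0$; - periodic, with a sign $\varepsilon\in\{1,-1\}$: $\mu_0=\mu_K$ and $K(T_0^1-\mathrm{id})=\varepsilon K(T_K^{K-1}-\mathrm{id})$, where $T_k^l$ is the optimal transport from $\mu_k$ to $\mu_l$. Since optimal maps need not exist, this means: there are $\Pi\in U_o(\mu_0,\mu_1)$ and $\Pi'\in U_o(\mu_K,\mu_{K-1})$ such that the image of $\Pi$ under $(x,y)\mapsto(x,K(y-x))$ equals the image of $\Pi'$ under $(x,y)\mapsto(x,\varepsilon K(y-x))$; - cyclic (periodicity encoded in the energy): no constraint, but all sums in the energies are continued by one more term, with $\mu_{K+1}=\mu_0$ (the path sum up to $k=K$, the spline sum up to $k=K$). In the Hermite and periodic cases assume that the constraints are compatible, i.e. that at least one tuple in $\mathcal P_2(\mathbb{R}^d)$ satisfies them all. Then, for each of these boundary conditions, $\mathbf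 F^{\delta,K}$ attains its minimum among all tuples in $\mathcal P(\mathbb{R}^d)$ that satisfy the constraints. More precisely, there is a minimizer all of whose entries lie in $\mathcal P_2(\mathbb{R}^d)$ and whose energy is finite. The same holds for the generalized energy $\mathbf F_G^{\delta,K}$. -/

import Mathlib

open MeasureTheory
open scoped ENNReal

namespace WassersteinSpline

/-- Euclidean space `ℝ^d`. -/
abbrev Rd (d : ℕ) : Type := EuclideanSpace ℝ (Fin d)

/-- Borel probability measures on `ℝ^d`. -/
abbrev Prob (d : ℕ) : Type := ProbabilityMeasure (Rd d)

/-- Borel probability measures on `ℝ^d × ℝ^d`. -/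
abbrev Plan (d : ℕ) : Type := ProbabilityMeasure (Rd d × Rd d)

/-- Probability measures with finite second moment. -/
def P2 (d : ℕ) : Set (Prob d) :=
  {μ | ∫⁻ x, ‖x‖ₑ ^ 2 ∂(μ : Measure (Rd d)) < ⊤}

/-- `U(μ,ν)`: the couplings of `μ` and `ν`. -/
def couplings {d : ℕ} (μ ν : Prob d) : Set (Plan d) :=
  {π | (π : Measure (Rd d × Rd d)).map Prod.fst = (μ : Measure (Rd d)) ∧
       (π : Measure (Rd d × Rd d)).map Prod.snd = (ν : Measure (Rd d))}

/-- The quadratic transport cost of a plan. -/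
noncomputable def cost {d : ℕ} (π : Plan d) : ℝ≥0∞ :=
  ∫⁻ p, edist p.1 p.2 ^ 2 ∂(π : Measure (Rd d × Rd d))

/-- `U_o(μ,ν)`: the optimal couplings of `μ` and `ν`. -/
def optCouplings {d : ℕ} (μ ν : Prob d) : Set (Plan d) :=
  {π | π ∈ couplings μ ν ∧ ∀ π' ∈ couplings μ ν, cost π ≤ cost π'}

/-- The squared Wasserstein distance, with values in `[0,∞]`. -/
noncomputable def W2sq {d : ℕ} (μ ν : Prob d) : ℝ≥0∞ :=
  ⨅ π ∈ couplings μ ν, cost π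

/-- The set of (`1/2`-)barycenters of `μ` and `ν`. -/
def Bar {d : ℕ} (μ ν : Prob d) : Set (Prob d) :=
  {β | ∀ ρ : Prob d,
    (1 / 2) * W2sq β μ + (1 / 2) * W2sq β ν ≤ (1 / 2) * W2sq ρ μ + (1 / 2) * W2sq ρ ν}

/-- `U_o(μ₁,μ₂,μ₃)`: three-measure couplings whose `(1,2)` and `(2,3)` marginals are optimal
couplings of `μ₁, μ₂` and of `μ₂, μ₃`. -/
def optCouplings₃ {d : ℕ} (μ₁ μ₂ μ₃ : Prob d) :
    Set (ProbabilityMeasure (Rd d × Rd d × Rd d)) :=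
  {Q | Q.map (f := fun p => (p.1, p.2.1)) (by fun_prop) ∈ optCouplings μ₁ μ₂ ∧
       Q.map (f := fun p => (p.2.1, p.2.2)) (by fun_prop) ∈ optCouplings μ₂ μ₃}

/-- The set of generalized (`1/2`-)barycenters of `μ₁` and `μ₃` with base point `μ₂`. -/
def GenBar {d : ℕ} (μ₂ μ₁ μ₃ : Prob d) : Set (Prob d) :=
  {β | ∃ Q ∈ optCouplings₃ μ₁ μ₂ μ₃,
    Q.map (f := fun p => (1 / 2 : ℝ) • p.1 + (1 / 2 : ℝ) • p.2.2) (by fun_prop) = β}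

/-- The squared Wasserstein distance of `μ` from a set of measures. It is used for sets of
barycenters, which need not be unique: the best one is taken. -/
noncomputable def W2sqSet {d : ℕ} (μ : Prob d) (S : Set (Prob d)) : ℝ≥0∞ :=
  ⨅ β ∈ S, W2sq μ β

/-- The discrete path energy with factor `K` of a tuple `(μ_0, …, μ_n)`. It is `𝐄^K` for
`n = K`. -/
noncomputable def pathEnergy {d : ℕ} (K : ℕ) {n : ℕ} (μ : Fin (n + 1) → Prob d) : ℝ≥0∞ :=
  K * ∑ k : Fin n, W2sq (μ k.castSucc) (μ k.succ)

/-- The discrete spline energy with factor `4K³` of a tuple `(μ_0, …, μ_n)`. The summation index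
`j` stands for `k = j + 1`, where `k = 1, …, n - 1`. It is `𝐅^K` for `n = K`. -/
noncomputable def splineEnergy {d : ℕ} (K : ℕ) {n : ℕ} (μ : Fin (n + 1) → Prob d) : ℝ≥0∞ :=
  4 * (K : ℝ≥0∞) ^ 3 * ∑ j : Fin (n - 1),
    W2sqSet (μ ⟨j + 1, by omega⟩) (Bar (μ ⟨j, by omega⟩) (μ ⟨j + 2, by omega⟩))

/-- The generalized discrete spline energy with factor `4K³` of a tuple `(μ_0, …, μ_n)`, indexed
in the same way. It is `𝐅_G^K` for `n = K`. -/
noncomputable def genSplineEnergy {d : ℕ} (K : ℕ) {n : ℕ} (μ : Fin (n + 1) → Prob d) : ℝ≥0∞ :=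
  4 * (K : ℝ≥0∞) ^ 3 * ∑ j : Fin (n - 1),
    W2sqSet (μ ⟨j + 1, by omega⟩)
      (GenBar (μ ⟨j + 1, by omega⟩) (μ ⟨j, by omega⟩) (μ ⟨j + 2, by omega⟩))

/-- `𝐅^{δ,K}`. -/
noncomputable def regSplineEnergy {d : ℕ} (δ : ℝ) (K : ℕ) {n : ℕ} (μ : Fin (n + 1) → Prob d) :
    ℝ≥0∞ :=
  splineEnergy K μ + ENNReal.ofReal δ * pathEnergy K μ

/-- `𝐅_G^{δ,K}`. -/
noncomputable def regGenSplineEnergy {d : ℕ} (δ : ℝ) (K : ℕ) {n : ℕ}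
    (μ : Fin (n + 1) → Prob d) : ℝ≥0∞ :=
  genSplineEnergy K μ + ENNReal.ofReal δ * pathEnergy K μ

/-- The interpolation constraints `μ_{K t_i} = μbar_i`. -/
def Interpolates {d K I : ℕ} (t : Fin I → ℝ) (μbar : Fin I → Prob d)
    (μ : Fin (K + 1) → Prob d) : Prop :=
  ∀ (i : Fin I) (k : Fin (K + 1)), ((k : ℕ) : ℝ) = K * t i → μ k = μbar i

/-- The boundary conditions.
* `natural`: no condition.
* `hermite a₀ a₁ b₁ b₀`: the measures with indices `0, 1, K - 1, K` are prescribed.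
* `periodic ε`: `μ_0 = μ_K` and `K (T_0^1 - id) = ε K (T_K^{K-1} - id)`, where `ε` is a sign. Here
  `T_k^l` is the optimal transport from `μ_k` to `μ_l`.
* `cyclic`: periodicity encoded in the energy, whose sums are continued by one more term with
  `μ_{K+1} = μ_0`. -/
inductive BoundaryCondition (d : ℕ) : Type
  | natural : BoundaryCondition d
  | hermite (a₀ a₁ b₁ b₀ : Prob d) : BoundaryCondition d
  | periodic (ε : ℤˣ) : BoundaryCondition d
  | cyclic : BoundaryCondition d

/-- The joint law of initial position and (scaled) displacement of a transport plan. For a plan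
`(id, T)_# μ` it is `(id, c (T - id))_# μ`. -/
noncomputable def displacementLaw {d : ℕ} (c : ℝ) (π : Plan d) : Measure (Rd d × Rd d) :=
  (π : Measure (Rd d × Rd d)).map (fun p => (p.1, c • (p.2 - p.1)))

/-- The constraint that a boundary condition puts on a tuple. Optimal transport maps
need not exist between general measures, so the periodic condition is expressed by optimal
couplings. -/
def BoundaryCondition.Holds {d K : ℕ} (hK : 2 ≤ K) (μ : Fin (K + 1) → Prob d) :
    BoundaryCondition d → Prop
  | natural => True
  | hermite a₀ a₁ b₁ b₀ =>
      μ 0 = a₀ ∧ μ ⟨1, by omega⟩ = a₁ ∧ μ ⟨K - 1, by omega⟩ = b₁ ∧ μ (Fin.last K) = b₀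
  | periodic ε =>
      μ 0 = μ (Fin.last K) ∧
      ∃ π ∈ optCouplings (μ 0) (μ ⟨1, by omega⟩),
      ∃ π' ∈ optCouplings (μ (Fin.last K)) (μ ⟨K - 1, by omega⟩),
        displacementLaw K π = displacementLaw (((ε : ℤ) : ℝ) * K) π'
  | cyclic => True

/-- The energy to be minimized under a boundary condition, for a given energy `J` on tuples of any
length: `J(μ_0, …, μ_K)`, but `J(μ_0, …, μ_K, μ_0)` for `cyclic`. -/
noncomputable def BoundaryCondition.energy {d K : ℕ}
    (J : ∀ {n : ℕ}, (Fin (n + 1) → Prob d) → ℝ≥0∞) (μ : Fin (K + 1) → Prob d) :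
    BoundaryCondition d → ℝ≥0∞
  | cyclic => J (Fin.snoc (α := fun _ => Prob d) μ (μ 0) : Fin (K + 1 + 1) → Prob d)
  | _ => J μ

/-- The tuples that satisfy the interpolation constraints and the boundary condition. -/
def Admissible {d K I : ℕ} (hK : 2 ≤ K) (t : Fin I → ℝ) (μbar : Fin I → Prob d)
    (bc : BoundaryCondition d) : Set (Fin (K + 1) → Prob d) :=
  {μ | Interpolates t μbar μ ∧ bc.Holds hK μ}

/-- `μ` is a discrete interpolation for the energy `J`: an admissible tuple in `P2` with finite
energy that minimizes the energy among all admissible tuples of probability measures. -/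
def IsDiscreteInterpolation {d K I : ℕ} (hK : 2 ≤ K)
    (J : ∀ {n : ℕ}, (Fin (n + 1) → Prob d) → ℝ≥0∞)
    (t : Fin I → ℝ) (μbar : Fin I → Prob d) (bc : BoundaryCondition d)
    (μ : Fin (K + 1) → Prob d) : Prop :=
  μ ∈ Admissible hK t μbar bc ∧ (∀ k, μ k ∈ P2 d) ∧ bc.energy J μ < ⊤ ∧
    ∀ ν ∈ Admissible hK t μbar bc, bc.energy J μ ≤ bc.energy J ν

end WassersteinSpline

/-! The proof is the direct method for weak convergence of probability measures. Interpolation fixes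
one entry with finite second moment, and the term `δ E` bounds consecutive distances, so every
competitor with energy below that of a fixed tuple in `P2` lies in a set of uniformly bounded second
moments (`exists_moment_bound`). Such sets are weakly compact by Markov and Prokhorov. It remains to
see that constraints and energies behave well on them.

Both reduce to one fact, `isCompact_optBall`: optimal plans with bounded marginal moments form a
compact set. Bounded moments do not make costs converge, so optimality of a weak limit is obtained
through cyclical monotonicity. The latter passes to supports of limits
(`cyclicallyMonotone_support_of_mem_closure`) and conversely implies optimality by Rockafellar's
potential (`mem_optCouplings_of_cyclicallyMonotone`).

By the parallelogram law, barycenters are exactly the midpoint laws of optimal plans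
(`Bar_eq_image`). Distances to ordinary and generalized barycenters thus become infima of a lower
semicontinuous function over fibres of a continuous map on a compact set, and these are lower
semicontinuous (`lowerSemicontinuous_iInf_fiber`). The periodic constraint is a projection of a
compact set of tuples and optimal plans. -/

namespace WassersteinSpline

open Filter Topology NNReal BoundedContinuousFunction ProbabilityTheory

/-! ### Push-forwards and lower semicontinuity for weak convergence -/

section Push

variable {X Y Z : Type*} [TopologicalSpace X] [MeasurableSpace X] [BorelSpace X]
  [TopologicalSpace Y] [MeasurableSpace Y] [BorelSpace Y]
  [TopologicalSpace Z] [MeasurableSpace Z] [BorelSpace Z]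

/-- Push-forward of a probability measure under a continuous map. -/
noncomputable def push {f : X → Y} (hf : Continuous f) (μ : ProbabilityMeasure X) :
    ProbabilityMeasure Y :=
  μ.map hf.measurable.aemeasurable

@[simp] lemma coe_push {f : X → Y} (hf : Continuous f) (μ : ProbabilityMeasure X) :
    (push hf μ : Measure Y) = (μ : Measure X).map f := rfl

@[fun_prop] lemma continuous_push {f : X → Y} (hf : Continuous f) : Continuous (push hf) :=
  ProbabilityMeasure.continuous_map hf

lemma push_push {f : X → Y} (hf : Continuous f) {g : Y → Z} (hg : Continuous g)
    (μ : ProbabilityMeasure X) : push hg (push hf μ) = push (hg.comp hf) μ := by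
  apply Subtype.ext
  simp [Measure.map_map hg.measurable hf.measurable]

lemma lintegral_push {f : X → Y} (hf : Continuous f) (μ : ProbabilityMeasure X) {g : Y → ℝ≥0∞}
    (hg : Measurable g) : ∫⁻ y, g y ∂(push hf μ : Measure Y) = ∫⁻ x, g (f x) ∂(μ : Measure X) :=
  lintegral_map hg hf.measurable

/-- The integral is the supremum over `n` of the integrals of `min f n`, which are weakly continuous
because these truncations are bounded and continuous. -/
lemma lowerSemicontinuous_lintegral {f : X → ℝ≥0∞} (hf : Continuous f) :
    LowerSemicontinuous fun μ : ProbabilityMeasure X => ∫⁻ x, f x ∂(μ : Measure X) := by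
  have key : ∀ μ : ProbabilityMeasure X,
      ∫⁻ x, f x ∂(μ : Measure X) = ⨆ n : ℕ, ∫⁻ x, min (f x) n ∂(μ : Measure X) := by
    intro μ
    rw [← lintegral_iSup (fun n => (hf.min continuous_const).measurable)]
    · congr 1 with x
      apply le_antisymm
      · by_cases hx : f x = ⊤
        · simp [hx, ENNReal.iSup_natCast]
        · obtain ⟨n, hn⟩ := ENNReal.exists_nat_gt hx
          exact (le_min le_rfl hn.le).trans (le_iSup (fun n : ℕ => min (f x) (n : ℝ≥0∞)) n)
      · exact iSup_le fun n => min_le_left _ _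
    · intro m n hmn x
      exact min_le_min le_rfl (by exact_mod_cast hmn)
  simp_rw [key]
  refine lowerSemicontinuous_iSup fun n => Continuous.lowerSemicontinuous ?_
  have hne : ∀ x, min (f x) n ≠ ⊤ := fun x => ((min_le_right _ _).trans_lt (by simp)).ne
  have hc : Continuous fun x => (min (f x) n).toNNReal :=
    ENNReal.continuousOn_toNNReal.comp_continuous (hf.min continuous_const) hne
  let g : X →ᵇ ℝ≥0 := BoundedContinuousFunction.mkOfBound ⟨_, hc⟩ n (by
    intro x y
    have hb : ∀ x, (min (f x) n).toNNReal ≤ n := fun x =>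
      by simpa using ENNReal.toNNReal_mono (ENNReal.natCast_ne_top n) (min_le_right (f x) n)
    rw [NNReal.dist_eq]
    have h1 : ((min (f x) n).toNNReal : ℝ) ≤ n := by exact_mod_cast hb x
    have h2 : ((min (f y) n).toNNReal : ℝ) ≤ n := by exact_mod_cast hb y
    simp only [ContinuousMap.coe_mk]
    rw [abs_le]
    constructor <;> linarith [NNReal.coe_nonneg (min (f x) n).toNNReal,
      NNReal.coe_nonneg (min (f y) n).toNNReal])
  have := ProbabilityMeasure.continuous_lintegral_boundedContinuousFunction g
  convert this using 4 with μ x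
  exact (ENNReal.coe_toNNReal (hne x)).symm

/-- The infimum of a lower semicontinuous function over the fibres of a continuous map on a compact
set is lower semicontinuous. -/
lemma lowerSemicontinuous_iInf_fiber {A B : Type*} [TopologicalSpace A] [TopologicalSpace B]
    [T2Space B] {S : Set A} (hS : IsCompact S) {p : A → B} (hp : Continuous p) {h : A → ℝ≥0∞}
    (hh : LowerSemicontinuousOn h S) :
    LowerSemicontinuous fun b => ⨅ a ∈ {a | a ∈ S ∧ p a = b}, h a := by
  rw [lowerSemicontinuous_iff_isClosed_preimage]
  intro c
  by_cases hc : c = ⊤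
  · simp [hc]
  -- An empty fibre has infimum `⊤`, so for `c < ⊤` the fibre is nonempty and compact and the
  -- infimum is attained. Sublevel sets are therefore images of compact sets.
  have : (fun b => ⨅ a ∈ {a | a ∈ S ∧ p a = b}, h a) ⁻¹' Set.Iic c = p '' (S ∩ h ⁻¹' Set.Iic c) := by
    ext b
    simp only [Set.mem_preimage, Set.mem_Iic, Set.mem_image, Set.mem_inter_iff]
    constructor
    · intro hb
      have hne : {a | a ∈ S ∧ p a = b}.Nonempty := by
        by_contra hne
        rw [Set.not_nonempty_iff_eq_empty] at hne
        rw [hne] at hb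
        simp [hc] at hb
      have hcomp : IsCompact {a | a ∈ S ∧ p a = b} :=
        hS.inter_right (isClosed_singleton.preimage hp)
      obtain ⟨a, ha, hmin⟩ := LowerSemicontinuousOn.exists_isMinOn hne hcomp
        (hh.mono fun a ha => ha.1)
      exact ⟨a, ⟨ha.1, (le_iInf₂ fun a' ha' => hmin ha').trans hb⟩, ha.2⟩
    · rintro ⟨a, ⟨ha, hac⟩, rfl⟩
      exact (iInf₂_le a ⟨ha, rfl⟩).trans hac
  rw [this]
  exact ((hh.isCompact_inter_preimage_Iic hS c).image hp).isClosed

end Push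

/-! ### Second moments and weak compactness -/

section Moment

variable {E F : Type*} [NormedAddCommGroup E] [MeasurableSpace E] [BorelSpace E]
  [NormedAddCommGroup F] [MeasurableSpace F] [BorelSpace F]

/-- The second moment of a probability measure. -/
noncomputable def secondMoment (μ : ProbabilityMeasure E) : ℝ≥0∞ :=
  ∫⁻ x, ‖x‖ₑ ^ 2 ∂(μ : Measure E)

lemma lowerSemicontinuous_secondMoment :
    LowerSemicontinuous (secondMoment : ProbabilityMeasure E → ℝ≥0∞) :=
  lowerSemicontinuous_lintegral (by fun_prop)

lemma isClosed_secondMoment_le (M : ℝ≥0∞) :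
    IsClosed {μ : ProbabilityMeasure E | secondMoment μ ≤ M} :=
  lowerSemicontinuous_secondMoment.isClosed_preimage M

lemma measure_compl_closedBall_le (μ : ProbabilityMeasure E) {M : ℝ≥0∞} (hμ : secondMoment μ ≤ M)
    {r : ℝ≥0} (hr : r ≠ 0) :
    (μ : Measure E) (Metric.closedBall 0 r)ᶜ ≤ M / (r : ℝ≥0∞) ^ 2 := by
  rw [ENNReal.le_div_iff_mul_le (by simp [hr]) (by simp), mul_comm]
  refine le_trans ?_ hμ
  refine le_trans ?_ (mul_meas_ge_le_lintegral (by fun_prop) ((r : ℝ≥0∞) ^ 2))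
  gcongr
  intro x hx
  simp only [Set.mem_compl_iff, Metric.mem_closedBall, dist_zero_right, not_le] at hx
  simp only [Set.mem_ofPred_eq]
  gcongr
  rw [enorm_eq_nnnorm]
  exact_mod_cast hx.le

/-- Markov's inequality gives tightness, since closed balls are compact. Prokhorov's theorem and
closedness of the moment bound do the rest. -/
lemma isCompact_secondMoment_le [ProperSpace E] {M : ℝ≥0∞} (hM : M ≠ ⊤) :
    IsCompact {μ : ProbabilityMeasure E | secondMoment μ ≤ M} := by
  rw [← (isClosed_secondMoment_le M).closure_eq]
  apply isCompact_closure_of_isTightMeasureSet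
  rw [isTightMeasureSet_iff_exists_isCompact_measure_compl_le]
  intro ε hε
  have : Tendsto (fun n : ℕ => M / ((n : ℝ≥0) : ℝ≥0∞) ^ 2) atTop (𝓝 0) := by
    have h2 : Tendsto (fun n : ℕ => ((n : ℝ≥0∞))) atTop (𝓝 ⊤) := ENNReal.tendsto_nat_nhds_top
    have h3 := (ENNReal.continuous_pow 2).continuousAt.tendsto.comp h2
    have h4 := ENNReal.Tendsto.const_div (a := M) h3 (Or.inr hM)
    simpa using h4
  obtain ⟨n, hn, hn0⟩ := ((this.eventually_le_const hε).and (eventually_ne_atTop 0)).exists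
  refine ⟨Metric.closedBall 0 (n : ℝ≥0), isCompact_closedBall _ _, ?_⟩
  rintro _ ⟨μ, hμ, rfl⟩
  exact (measure_compl_closedBall_le μ hμ (by exact_mod_cast hn0)).trans hn

lemma secondMoment_push_le {f : E → F} (hf : Continuous f) (h : ∀ x, ‖f x‖ₑ ≤ ‖x‖ₑ)
    (μ : ProbabilityMeasure E) : secondMoment (push hf μ) ≤ secondMoment μ := by
  rw [secondMoment, lintegral_push hf μ (by fun_prop)]
  exact lintegral_mono fun x => by gcongr; exact h x

/-- The product carries the maximum norm, whose square is at most the sum of the two squares. -/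
lemma secondMoment_prod_le [SecondCountableTopology E] [SecondCountableTopology F]
    (π : ProbabilityMeasure (E × F)) :
    secondMoment π ≤ secondMoment (push continuous_fst π) + secondMoment (push continuous_snd π) := by
  simp only [secondMoment]
  rw [lintegral_push _ _ (by fun_prop), lintegral_push _ _ (by fun_prop), ← lintegral_add_left (by fun_prop)]
  refine lintegral_mono fun p => ?_
  simp only [enorm_eq_nnnorm, Prod.nnnorm_def]
  rcases max_choice ‖p.1‖₊ ‖p.2‖₊ with h | h <;> rw [h]
  · exact le_self_add
  · exact le_add_self

end Moment

/-! ### Couplings, gluing, and existence of optimal plans -/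

section Couplings

variable {d : ℕ}

lemma mem_couplings_iff {μ ν : Prob d} {π : Plan d} :
    π ∈ couplings μ ν ↔ push continuous_fst π = μ ∧ push continuous_snd π = ν := by
  exact and_congr ⟨fun h => ProbabilityMeasure.toMeasure_injective h, fun h => congrArg ProbabilityMeasure.toMeasure h⟩
    ⟨fun h => ProbabilityMeasure.toMeasure_injective h, fun h => congrArg ProbabilityMeasure.toMeasure h⟩

lemma mem_P2_iff {μ : Prob d} : μ ∈ P2 d ↔ secondMoment μ < ⊤ := Iff.rfl

lemma W2sq_le {μ ν : Prob d} {π : Plan d} (h : π ∈ couplings μ ν) : W2sq μ ν ≤ cost π :=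
  iInf₂_le π h

lemma optCouplings_cost {μ ν : Prob d} {π : Plan d} (h : π ∈ optCouplings μ ν) :
    cost π = W2sq μ ν :=
  le_antisymm (le_iInf₂ h.2) (W2sq_le h.1)

lemma mem_optCouplings_iff {μ ν : Prob d} {π : Plan d} :
    π ∈ optCouplings μ ν ↔ π ∈ couplings μ ν ∧ cost π ≤ W2sq μ ν :=
  ⟨fun h => ⟨h.1, (optCouplings_cost h).le⟩, fun h => ⟨h.1, fun _ h' => h.2.trans (W2sq_le h')⟩⟩

lemma lowerSemicontinuous_cost : LowerSemicontinuous (cost : Plan d → ℝ≥0∞) :=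
  lowerSemicontinuous_lintegral (by fun_prop)

lemma cost_push {X : Type*} [TopologicalSpace X] [MeasurableSpace X] [BorelSpace X]
    {f : X → Rd d × Rd d} (hf : Continuous f) (μ : ProbabilityMeasure X) :
    cost (push hf μ) = ∫⁻ x, edist (f x).1 (f x).2 ^ 2 ∂(μ : Measure X) :=
  lintegral_push hf μ (g := fun p => edist p.1 p.2 ^ 2) (by fun_prop)

lemma cost_swap (π : Plan d) : cost (push continuous_swap π) = cost π := by
  rw [cost_push]
  simp [cost, edist_comm]

lemma swap_mem_couplings {μ ν : Prob d} {π : Plan d} (h : π ∈ couplings μ ν) :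
    push continuous_swap π ∈ couplings ν μ := by
  rw [mem_couplings_iff] at h ⊢
  rw [push_push, push_push]
  exact ⟨h.2, h.1⟩

lemma W2sq_comm (μ ν : Prob d) : W2sq μ ν = W2sq ν μ := by
  have key : ∀ μ ν : Prob d, W2sq μ ν ≤ W2sq ν μ := fun μ ν =>
    le_iInf₂ fun π hπ => (W2sq_le (swap_mem_couplings hπ)).trans (cost_swap π).le
  exact le_antisymm (key _ _) (key _ _)

lemma couplings_nonempty (μ ν : Prob d) : (couplings μ ν).Nonempty := by
  refine ⟨⟨(μ : Measure (Rd d)).prod ν, inferInstance⟩, ?_, ?_⟩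
  · exact Measure.fst_prod
  · exact Measure.snd_prod

/-- Gluing of two plans along their common marginal. -/
lemma exists_glue {π π' : Plan d} (h : push continuous_snd π = push continuous_fst π') :
    ∃ Q : ProbabilityMeasure (Rd d × Rd d × Rd d),
      push (f := fun p => (p.1, p.2.1)) (by fun_prop) Q = π ∧ push continuous_snd Q = π' := by
  -- The third coordinate is drawn from the disintegration of `π'` given the middle one,
  -- independently of the first.
  let κ : Kernel (Rd d × Rd d) (Rd d) :=
    (π' : Measure (Rd d × Rd d)).condKernel.comap Prod.snd measurable_snd
  let R : ProbabilityMeasure ((Rd d × Rd d) × Rd d) :=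
    ⟨(π : Measure (Rd d × Rd d)) ⊗ₘ κ, inferInstance⟩
  refine ⟨push (f := fun r => (r.1.1, r.1.2, r.2)) (by fun_prop) R, ?_, ?_⟩
  · rw [push_push]
    exact Subtype.ext (Measure.fst_compProd (π : Measure (Rd d × Rd d)) κ)
  · rw [push_push]
    apply ProbabilityMeasure.toMeasure_injective
    have h' : (π : Measure (Rd d × Rd d)).map Prod.snd = (π' : Measure (Rd d × Rd d)).fst :=
      congrArg Subtype.val h
    conv_rhs => rw [← (π' : Measure (Rd d × Rd d)).disintegrate
      (π' : Measure (Rd d × Rd d)).condKernel, ← h']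
    ext s hs
    rw [coe_push, Measure.map_apply (by fun_prop) hs, Measure.compProd_apply hs,
      lintegral_map (Kernel.measurable_kernel_prodMk_left hs) measurable_snd]
    exact Measure.compProd_apply (by measurability)

/-- Both summands are replaced by the larger one. The constant is not sharp, but only finiteness of
the resulting bounds matters. -/
lemma sq_add_le_four (a b : ℝ≥0∞) : (a + b) ^ 2 ≤ 4 * a ^ 2 + 4 * b ^ 2 := by
  have key : ∀ a b : ℝ≥0∞, a ≤ b → (a + b) ^ 2 ≤ 4 * a ^ 2 + 4 * b ^ 2 := by
    intro a b hab
    calc (a + b) ^ 2 ≤ (b + b) ^ 2 := by gcongr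
      _ = 4 * b ^ 2 := by ring
      _ ≤ _ := le_add_self
  rcases le_total a b with h | h
  · exact key a b h
  · rw [add_comm a b, add_comm (4 * a ^ 2)]
    exact key b a h

lemma secondMoment_le_cost {μ ν : Prob d} {π : Plan d} (h : π ∈ couplings μ ν) :
    secondMoment ν ≤ 4 * secondMoment μ + 4 * cost π := by
  obtain ⟨rfl, rfl⟩ := mem_couplings_iff.1 h
  simp only [secondMoment, cost]
  rw [lintegral_push _ _ (by fun_prop), lintegral_push _ _ (by fun_prop),
    ← lintegral_const_mul _ (by fun_prop), ← lintegral_const_mul _ (by fun_prop),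
    ← lintegral_add_left (by fun_prop)]
  refine lintegral_mono fun p => le_trans ?_ (sq_add_le_four _ _)
  gcongr
  rw [← edist_zero_right, ← edist_zero_right, add_comm, edist_comm p.1 p.2]
  exact edist_triangle _ _ _

lemma secondMoment_le_W2sq (μ ν : Prob d) :
    secondMoment ν ≤ 4 * secondMoment μ + 4 * W2sq μ ν := by
  simp only [W2sq]
  rw [ENNReal.mul_iInf_of_ne (by simp) (by simp), ENNReal.add_iInf]
  refine le_iInf fun π => ?_
  rw [ENNReal.mul_iInf_of_ne (by simp) (by simp)]
  by_cases h : π ∈ couplings μ ν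
  · simpa [h] using secondMoment_le_cost h
  · simp [h]

lemma cost_le_secondMoment {μ ν : Prob d} {π : Plan d} (h : π ∈ couplings μ ν) :
    cost π ≤ 4 * secondMoment μ + 4 * secondMoment ν := by
  obtain ⟨rfl, rfl⟩ := mem_couplings_iff.1 h
  simp only [secondMoment, cost]
  rw [lintegral_push _ _ (by fun_prop), lintegral_push _ _ (by fun_prop),
    ← lintegral_const_mul _ (by fun_prop), ← lintegral_const_mul _ (by fun_prop),
    ← lintegral_add_left (by fun_prop)]
  refine lintegral_mono fun p => le_trans ?_ (sq_add_le_four _ _)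
  gcongr
  rw [edist_eq_enorm_sub]
  exact enorm_sub_le

lemma cost_ne_top {μ ν : Prob d} (hμ : μ ∈ P2 d) (hν : ν ∈ P2 d) {π : Plan d}
    (h : π ∈ couplings μ ν) : cost π ≠ ⊤ := by
  rw [mem_P2_iff] at hμ hν
  refine ((cost_le_secondMoment h).trans_lt ?_).ne
  exact ENNReal.add_lt_top.2 ⟨ENNReal.mul_lt_top (by simp) hμ, ENNReal.mul_lt_top (by simp) hν⟩

lemma W2sq_ne_top {μ ν : Prob d} (hμ : μ ∈ P2 d) (hν : ν ∈ P2 d) : W2sq μ ν ≠ ⊤ := by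
  obtain ⟨π, hπ⟩ := couplings_nonempty μ ν
  exact ne_top_of_le_ne_top (cost_ne_top hμ hν hπ) (W2sq_le hπ)

/-- This brings arbitrary competitors in the barycenter problem back to `P2`, where optimal plans
exist. -/
lemma mem_P2_of_W2sq_ne_top {μ ν : Prob d} (hμ : μ ∈ P2 d) (h : W2sq μ ν ≠ ⊤) : ν ∈ P2 d := by
  rw [mem_P2_iff] at hμ ⊢
  refine (secondMoment_le_W2sq μ ν).trans_lt ?_
  exact ENNReal.add_lt_top.2 ⟨ENNReal.mul_lt_top (by simp) hμ,
    ENNReal.mul_lt_top (by simp) h.lt_top⟩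

/-- Plans whose marginals have second moment at most `M`. -/
def planBall (d : ℕ) (M : ℝ≥0∞) : Set (Plan d) :=
  {π | secondMoment (push continuous_fst π) ≤ M ∧ secondMoment (push continuous_snd π) ≤ M}

lemma isCompact_planBall {M : ℝ≥0∞} (hM : M ≠ ⊤) : IsCompact (planBall d M) := by
  refine (isCompact_secondMoment_le (M := M + M) (by simp [hM])).of_isClosed_subset ?_ ?_
  · exact ((isClosed_secondMoment_le M).preimage (continuous_push continuous_fst)).inter
      ((isClosed_secondMoment_le M).preimage (continuous_push continuous_snd))
  · intro π hπ
    exact (secondMoment_prod_le π).trans (add_le_add hπ.1 hπ.2)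

lemma optCouplings_nonempty {μ ν : Prob d} (hμ : μ ∈ P2 d) (hν : ν ∈ P2 d) :
    (optCouplings μ ν).Nonempty := by
  rw [mem_P2_iff] at hμ hν
  have hcl : IsClosed (couplings μ ν) := by
    have : couplings μ ν = push continuous_fst ⁻¹' {μ} ∩ push continuous_snd ⁻¹' {ν} := by
      ext π
      simp [mem_couplings_iff]
    rw [this]
    exact (isClosed_singleton.preimage (continuous_push _)).inter
      (isClosed_singleton.preimage (continuous_push _))
  have hc : IsCompact (couplings μ ν) := by
    refine (isCompact_planBall (d := d) (max_lt hμ hν).ne).of_isClosed_subset hcl ?_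
    intro π hπ
    obtain ⟨rfl, rfl⟩ := mem_couplings_iff.1 hπ
    exact ⟨le_max_left _ _, le_max_right _ _⟩
  obtain ⟨π, hπ, hmin⟩ := LowerSemicontinuousOn.exists_isMinOn (couplings_nonempty μ ν) hc
    (lowerSemicontinuous_cost.lowerSemicontinuousOn _)
  exact ⟨π, hπ, fun π' h => hmin h⟩

end Couplings

/-! ### Optimality implies cyclical monotonicity, also for weak limits -/

section CyclicalMonotonicity

variable {d : ℕ}

/-- A part of an optimal plan of finite cost is optimal among the measures with its marginals. -/
lemma lintegral_le_of_le_optCoupling {μ ν : Prob d} {π : Plan d} (hπ : π ∈ optCouplings μ ν)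
    (hfin : cost π ≠ ⊤) {θ η : Measure (Rd d × Rd d)} {C : ℝ≥0∞} (hC0 : C ≠ 0) (hC : C ≠ ⊤)
    (hθ : θ ≤ C • (π : Measure (Rd d × Rd d)))
    (h₁ : η.map Prod.fst = θ.map Prod.fst) (h₂ : η.map Prod.snd = θ.map Prod.snd) :
    ∫⁻ p, edist p.1 p.2 ^ 2 ∂θ ≤ ∫⁻ p, edist p.1 p.2 ^ 2 ∂η := by
  have hle : C⁻¹ • θ ≤ (π : Measure (Rd d × Rd d)) := by
    calc C⁻¹ • θ ≤ C⁻¹ • (C • (π : Measure (Rd d × Rd d))) := by gcongr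
      _ = π := by rw [smul_smul, ENNReal.inv_mul_cancel hC0 hC, one_smul]
  have : IsFiniteMeasure (C⁻¹ • θ) := isFiniteMeasure_of_le _ hle
  -- Exchanging the part `C⁻¹ • θ` of `π` for `C⁻¹ • η` keeps both marginals, so `ρ + C⁻¹ • η` is a
  -- competitor. The finite cost of `ρ` then cancels.
  set ρ := (π : Measure (Rd d × Rd d)) - C⁻¹ • θ with hρ
  have hsum : ρ + C⁻¹ • θ = π := Measure.sub_add_cancel_of_le hle
  have m₁ : (ρ + C⁻¹ • η).map Prod.fst = (μ : Measure (Rd d)) := by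
    rw [Measure.map_add _ _ measurable_fst, Measure.map_smul, h₁, ← Measure.map_smul,
      ← Measure.map_add _ _ measurable_fst, hsum]
    exact hπ.1.1
  have m₂ : (ρ + C⁻¹ • η).map Prod.snd = (ν : Measure (Rd d)) := by
    rw [Measure.map_add _ _ measurable_snd, Measure.map_smul, h₂, ← Measure.map_smul,
      ← Measure.map_add _ _ measurable_snd, hsum]
    exact hπ.1.2
  have hprob : IsProbabilityMeasure (ρ + C⁻¹ • η) := by
    constructor
    rw [← Set.preimage_univ (f := Prod.fst), ← Measure.map_apply measurable_fst .univ, m₁]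
    exact measure_univ
  have hopt := hπ.2 ⟨ρ + C⁻¹ • η, hprob⟩ ⟨m₁, m₂⟩
  simp only [cost, ProbabilityMeasure.coe_mk] at hopt hfin
  rw [← hsum, lintegral_add_measure, lintegral_smul_measure] at hfin hopt
  rw [lintegral_add_measure, lintegral_smul_measure] at hopt
  have h3 := (ENNReal.add_le_add_iff_left (ENNReal.add_ne_top.1 hfin).1).1 hopt
  simp only [smul_eq_mul] at h3
  exact (ENNReal.mul_le_mul_iff_right (ENNReal.inv_ne_zero.2 hC) (ENNReal.inv_ne_top.2 hC0)).1 h3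

/-- Cyclical monotonicity with points thickened to boxes: the plan conditioned on each box is
rearranged by pairing the first marginal from box `σ i` with the second marginal from box `i`.
Unlike a statement on points, this form survives a passage to nearby plans. -/
lemma sum_le_sum_of_optCoupling {μ ν : Prob d} {π : Plan d} (hπ : π ∈ optCouplings μ ν)
    (hfin : cost π ≠ ⊤) {ι : Type*} [Fintype ι] (σ : Equiv.Perm ι) {V W : ι → Set (Rd d)}
    (hV : ∀ i, MeasurableSet (V i)) (hW : ∀ i, MeasurableSet (W i))
    (hpos : ∀ i, (π : Measure (Rd d × Rd d)) (V i ×ˢ W i) ≠ 0) {a b : ι → ℝ≥0∞}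
    (ha : ∀ i, ∀ x ∈ V i, ∀ y ∈ W i, a i ≤ edist x y ^ 2)
    (hb : ∀ i, ∀ x ∈ V (σ i), ∀ y ∈ W i, edist x y ^ 2 ≤ b i) :
    ∑ i, a i ≤ ∑ i, b i := by
  let P : Measure (Rd d × Rd d) := π
  let θ : ι → Measure (Rd d × Rd d) := fun i => P[|V i ×ˢ W i]
  have hprob : ∀ i, IsProbabilityMeasure (θ i) := fun i => cond_isProbabilityMeasure (hpos i)
  have hmem : ∀ i, ∀ᵐ p ∂(θ i), p ∈ V i ×ˢ W i := fun i => ae_cond_mem ((hV i).prod (hW i))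
  -- Each conditioned plan is at most `(P (V i ×ˢ W i))⁻¹ • P`. The summand `1` keeps `C` nonzero
  -- for empty `ι`.
  let C : ℝ≥0∞ := 1 + ∑ i, (P (V i ×ˢ W i))⁻¹
  have hC : C ≠ ⊤ := by
    simp only [C, ne_eq, ENNReal.add_eq_top, ENNReal.one_ne_top, ENNReal.sum_eq_top, false_or]
    rintro ⟨i, -, hi⟩
    exact ENNReal.inv_ne_top.2 (hpos i) hi
  have hC0 : C ≠ 0 := by simp [C]
  have hle : ∑ i, θ i ≤ C • P := by
    calc ∑ i, θ i ≤ ∑ i, (P (V i ×ˢ W i))⁻¹ • P := by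
          refine Finset.sum_le_sum fun i _ => ?_
          simp only [θ, ProbabilityTheory.cond]
          gcongr
          exact Measure.restrict_le_self
      _ = (∑ i, (P (V i ×ˢ W i))⁻¹) • P := (Finset.sum_smul ..).symm
      _ ≤ C • P := by
          gcongr
          exact le_add_self
  let η : Measure (Rd d × Rd d) := ∑ i, (θ (σ i)).fst.prod (θ i).snd
  have h₁ : η.map Prod.fst = (∑ i, θ i).map Prod.fst := by
    rw [Measure.map_finset_sum measurable_fst.aemeasurable,
      Measure.map_finset_sum measurable_fst.aemeasurable,
      ← Equiv.sum_comp σ fun i => (θ i).map Prod.fst]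
    exact Finset.sum_congr rfl fun i _ => Measure.fst_prod
  have h₂ : η.map Prod.snd = (∑ i, θ i).map Prod.snd := by
    rw [Measure.map_finset_sum measurable_snd.aemeasurable,
      Measure.map_finset_sum measurable_snd.aemeasurable]
    exact Finset.sum_congr rfl fun i _ => Measure.snd_prod
  have key := lintegral_le_of_le_optCoupling hπ hfin hC0 hC hle h₁ h₂
  rw [lintegral_finsetSum_measure, lintegral_finsetSum_measure] at key
  refine le_trans ?_ (key.trans ?_)
  · refine Finset.sum_le_sum fun i _ => ?_
    calc a i = ∫⁻ _, a i ∂(θ i) := by simp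
      _ ≤ _ := lintegral_mono_ae ((hmem i).mono fun p hp => ha i _ hp.1 _ hp.2)
  · refine Finset.sum_le_sum fun i _ => ?_
    calc _ ≤ ∫⁻ _, b i ∂((θ (σ i)).fst.prod (θ i).snd) := by
          refine lintegral_mono_ae ?_
          have e₁ : ∀ᵐ x ∂(θ (σ i)).fst, x ∈ V (σ i) :=
            (ae_map_iff measurable_fst.aemeasurable (hV _)).2 ((hmem (σ i)).mono fun p hp => hp.1)
          have e₂ : ∀ᵐ y ∂(θ i).snd, y ∈ W i :=
            (ae_map_iff measurable_snd.aemeasurable (hW _)).2 ((hmem i).mono fun p hp => hp.2)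
          have e₁' := Measure.quasiMeasurePreserving_fst (ν := (θ i).snd) |>.ae e₁
          have e₂' := Measure.quasiMeasurePreserving_snd (μ := (θ (σ i)).fst) |>.ae e₂
          filter_upwards [e₁', e₂'] with p hp₁ hp₂ using hb i _ hp₁ _ hp₂
      _ = b i := by simp

/-- Cyclical monotonicity for the quadratic cost. -/
def CyclicallyMonotone (Γ : Set (Rd d × Rd d)) : Prop :=
  ∀ (n : ℕ) (σ : Equiv.Perm (Fin n)) (P : Fin n → Rd d × Rd d), (∀ i, P i ∈ Γ) →
    ∑ i, dist (P i).1 (P i).2 ^ 2 ≤ ∑ i, dist (P (σ i)).1 (P i).2 ^ 2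

/-- Small boxes around support points of `π` have positive mass, and by the portmanteau theorem keep
it for nearby plans. One of these is optimal with finite cost, and the box estimate applies to it.
No convergence of costs is needed. -/
lemma cyclicallyMonotone_support_of_mem_closure {π : Plan d}
    (hπ : π ∈ closure {π : Plan d | ∃ μ ν, π ∈ optCouplings μ ν ∧ cost π ≠ ⊤}) :
    CyclicallyMonotone (π : Measure (Rd d × Rd d)).support := by
  intro n σ P hP
  refine le_of_forall_pos_le_add fun ε hε => ?_
  -- Each side of the inequality loses at most `n * e`; the added `1` covers `n = 0`.
  set e : ℝ := ε / (2 * n + 1) with he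
  have hepos : 0 < e := by positivity
  have hcont : ∀ i j, ∀ᶠ r in 𝓝[>] (0 : ℝ), ∀ x ∈ Metric.ball (P i).1 r,
      ∀ y ∈ Metric.ball (P j).2 r, |dist x y ^ 2 - dist (P i).1 (P j).2 ^ 2| < e := by
    intro i j
    have h1 : Continuous fun p : Rd d × Rd d => dist p.1 p.2 ^ 2 := by fun_prop
    obtain ⟨r, hr, h2⟩ := Metric.continuous_iff.1 h1 ((P i).1, (P j).2) e hepos
    filter_upwards [Ioo_mem_nhdsGT hr] with s hs x hx y hy
    have := h2 (x, y) (by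
      rw [Prod.dist_eq]
      exact max_lt (hx.trans hs.2) (hy.trans hs.2))
    simpa [Real.dist_eq] using this
  obtain ⟨r, hr, hr0⟩ := ((eventually_all.2 fun i => eventually_all.2 fun j => hcont i j).and
    self_mem_nhdsWithin).exists
  replace hr0 : 0 < r := hr0
  have hne : (𝓝[{π : Plan d | ∃ μ ν, π ∈ optCouplings μ ν ∧ cost π ≠ ⊤}] π).NeBot :=
    mem_closure_iff_nhdsWithin_neBot.1 hπ
  have hopen : ∀ i, ∀ᶠ θ : Plan d in 𝓝[{π : Plan d | ∃ μ ν, π ∈ optCouplings μ ν ∧ cost π ≠ ⊤}] π,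
      (θ : Measure (Rd d × Rd d)) (Metric.ball (P i).1 r ×ˢ Metric.ball (P i).2 r) ≠ 0 := by
    intro i
    have hpos : 0 < (π : Measure (Rd d × Rd d)) (Metric.ball (P i).1 r ×ˢ Metric.ball (P i).2 r) :=
      (Measure.mem_support_iff_forall _).1 (hP i) _
        (prod_mem_nhds (Metric.ball_mem_nhds _ hr0) (Metric.ball_mem_nhds _ hr0))
    have hlim := ProbabilityMeasure.le_liminf_measure_open_of_tendsto
      (tendsto_id.mono_left (nhdsWithin_le_nhds
        (s := {π : Plan d | ∃ μ ν, π ∈ optCouplings μ ν ∧ cost π ≠ ⊤})))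
      ((Metric.isOpen_ball (x := (P i).1) (ε := r)).prod
        (Metric.isOpen_ball (x := (P i).2) (ε := r))) (μ := π)
    exact (eventually_lt_of_lt_liminf (hpos.trans_le hlim)).mono fun θ hθ => hθ.ne'
  obtain ⟨θ, hθpos, μ, ν, hθ, hfin⟩ :=
    ((eventually_all.2 hopen).and self_mem_nhdsWithin).exists
  have edist_sq : ∀ x y : Rd d, edist x y ^ 2 = ENNReal.ofReal (dist x y ^ 2) := fun x y => by
    rw [edist_dist, ENNReal.ofReal_pow dist_nonneg]
  have key := sum_le_sum_of_optCoupling hθ hfin σ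
    (V := fun i => Metric.ball (P i).1 r) (W := fun i => Metric.ball (P i).2 r)
    (fun i => Metric.isOpen_ball.measurableSet) (fun i => Metric.isOpen_ball.measurableSet) hθpos
    (a := fun i => ENNReal.ofReal (max (dist (P i).1 (P i).2 ^ 2 - e) 0))
    (b := fun i => ENNReal.ofReal (dist (P (σ i)).1 (P i).2 ^ 2 + e))
    (fun i x hx y hy => by
      rw [edist_sq]
      refine ENNReal.ofReal_le_ofReal (max_le ?_ (by positivity))
      linarith [(abs_lt.1 (hr i i x hx y hy)).1])
    (fun i x hx y hy => by
      rw [edist_sq]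
      refine ENNReal.ofReal_le_ofReal ?_
      linarith [(abs_lt.1 (hr (σ i) i x hx y hy)).2])
  rw [← ENNReal.ofReal_sum_of_nonneg (fun i _ => le_max_right _ _),
    ← ENNReal.ofReal_sum_of_nonneg (fun i _ => by positivity),
    ENNReal.ofReal_le_ofReal_iff (Finset.sum_nonneg fun i _ => by positivity)] at key
  have h1 : ∑ i, (dist (P i).1 (P i).2 ^ 2 - e) ≤
      ∑ i, max (dist (P i).1 (P i).2 ^ 2 - e) 0 := Finset.sum_le_sum fun i _ => le_max_left _ _
  have h2 := h1.trans key
  rw [Finset.sum_sub_distrib, Finset.sum_add_distrib] at h2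
  simp only [Finset.sum_const, Finset.card_univ, Fintype.card_fin, nsmul_eq_mul] at h2
  have h3 : e * (2 * n + 1) = ε := by rw [he]; field_simp
  nlinarith

end CyclicalMonotonicity

/-! ### Cyclical monotonicity implies optimality -/

section Potential

variable {d : ℕ}

/-- The value at `z` of the chain `P 0, …, P n` in Rockafellar's construction of a potential. -/
noncomputable def chainValue (n : ℕ) (P : ℕ → Rd d × Rd d) (z : Rd d) : ℝ :=
  ∑ i ∈ Finset.range n, (dist (P i).1 (P i).2 ^ 2 - dist (P (i + 1)).1 (P i).2 ^ 2) +
    (dist (P n).1 (P n).2 ^ 2 - dist z (P n).2 ^ 2)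

lemma continuous_chainValue (n : ℕ) (P : ℕ → Rd d × Rd d) : Continuous (chainValue n P) := by
  unfold chainValue
  fun_prop

/-- Evaluating at the starting point closes the chain to a cycle, so this is cyclical monotonicity
for the shift permutation. -/
lemma chainValue_nonpos {Γ : Set (Rd d × Rd d)} (hΓ : CyclicallyMonotone Γ) (n : ℕ)
    {P : ℕ → Rd d × Rd d} (hP : ∀ i, P i ∈ Γ) : chainValue n P (P 0).1 ≤ 0 := by
  have h := hΓ (n + 1) (Equiv.addRight 1) (fun i => P i) (fun i => hP i)
  rw [Fin.sum_univ_castSucc, Fin.sum_univ_castSucc] at h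
  simp only [Equiv.coe_addRight, Fin.coeSucc_eq_succ, Fin.last_add_one, Fin.val_succ,
    Fin.val_castSucc, Fin.val_last, Fin.val_zero] at h
  rw [Fin.sum_univ_eq_sum_range (fun i => dist (P i).1 (P i).2 ^ 2),
    Fin.sum_univ_eq_sum_range (fun i => dist (P (i + 1)).1 (P i).2 ^ 2)] at h
  rw [chainValue, Finset.sum_sub_distrib]
  linarith

lemma chainValue_succ (n : ℕ) (P : ℕ → Rd d × Rd d) (q : Rd d × Rd d) (z : Rd d) :
    chainValue (n + 1) (fun i => if i ≤ n then P i else q) z =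
      chainValue n P q.1 + (dist q.1 q.2 ^ 2 - dist z q.2 ^ 2) := by
  simp only [chainValue, Finset.sum_range_succ, le_refl, if_true, Nat.not_succ_le_self, if_false]
  congr 2
  refine Finset.sum_congr rfl fun i hi => ?_
  have hi := Finset.mem_range.1 hi
  rw [if_pos hi.le, if_pos (Nat.succ_le_of_lt hi)]

/-- Rockafellar's potential of a cyclically monotone set, finite on the set `D`. -/
lemma CyclicallyMonotone.exists_potential {Γ : Set (Rd d × Rd d)} (hΓ : CyclicallyMonotone Γ)
    {p₀ : Rd d × Rd d} (hp₀ : p₀ ∈ Γ) :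
    ∃ (φ : Rd d → ℝ) (D : Set (Rd d)), Measurable φ ∧ MeasurableSet D ∧ (∀ q ∈ Γ, q.1 ∈ D) ∧
      (∀ q ∈ Γ, ∀ z ∈ D, φ q.1 + (dist q.1 q.2 ^ 2 - dist z q.2 ^ 2) ≤ φ z) ∧
      (∀ z ∈ D, dist p₀.1 p₀.2 ^ 2 - dist z p₀.2 ^ 2 ≤ φ z) ∧
      (∀ q ∈ Γ, φ q.1 ≤ dist p₀.1 q.2 ^ 2 - dist q.1 q.2 ^ 2) := by
  let J : Set (ℕ × (ℕ → Rd d × Rd d)) := {j | j.2 0 = p₀ ∧ ∀ i, j.2 i ∈ Γ}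
  -- The supremum may be `⊤` off the first projection of `Γ`, hence `EReal` and the set `D`. The
  -- family is uncountable; measurability comes from lower semicontinuity.
  let Φ : Rd d → EReal := fun z => ⨆ j : J, ((chainValue j.1.1 j.1.2 z : ℝ) : EReal)
  have hmeas : Measurable Φ :=
    (lowerSemicontinuous_iSup fun j : J => (continuous_coe_real_ereal.comp
      (continuous_chainValue j.1.1 j.1.2)).lowerSemicontinuous).measurable
  have hle : ∀ (j : J) z, ((chainValue j.1.1 j.1.2 z : ℝ) : EReal) ≤ Φ z := fun j z =>
    le_iSup (fun j : J => ((chainValue j.1.1 j.1.2 z : ℝ) : EReal)) j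
  let j₀ : J := ⟨(0, fun _ => p₀), rfl, fun _ => hp₀⟩
  have hlow : ∀ z, ((dist p₀.1 p₀.2 ^ 2 - dist z p₀.2 ^ 2 : ℝ) : EReal) ≤ Φ z := fun z => by
    simpa [chainValue, j₀] using hle j₀ z
  have hbot : ∀ z, Φ z ≠ ⊥ := fun z h => by
    have := hlow z
    rw [h, le_bot_iff] at this
    exact EReal.coe_ne_bot _ this
  have happend : ∀ (j : J), ∀ q ∈ Γ,
      ((j.1.1 + 1, fun i => if i ≤ j.1.1 then j.1.2 i else q) : ℕ × (ℕ → Rd d × Rd d)) ∈ J := by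
    intro j q hq
    refine ⟨by simpa using j.2.1, fun i => ?_⟩
    simp only
    split_ifs
    · exact j.2.2 i
    · exact hq
  -- A chain ending at `q.1` is extended by `q` and closed up at `p₀.1`.
  have hup : ∀ q ∈ Γ, Φ q.1 ≤ ((dist p₀.1 q.2 ^ 2 - dist q.1 q.2 ^ 2 : ℝ) : EReal) := by
    intro q hq
    refine iSup_le fun j => EReal.coe_le_coe_iff.2 ?_
    have hj := happend j q hq
    have := chainValue_nonpos hΓ (j.1.1 + 1) hj.2
    rw [hj.1, chainValue_succ] at this
    linarith
  have hD : ∀ q ∈ Γ, Φ q.1 ≠ ⊤ := fun q hq h => by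
    have := hup q hq
    rw [h, top_le_iff] at this
    exact EReal.coe_ne_top _ this
  refine ⟨fun z => (Φ z).toReal, {z | Φ z ≠ ⊤}, hmeas.ereal_toReal,
    (measurableSet_eq_fun hmeas measurable_const).compl, hD, ?_, ?_, ?_⟩
  · intro q hq z hz
    have h1 : Φ q.1 ≤ (((Φ z).toReal - (dist q.1 q.2 ^ 2 - dist z q.2 ^ 2) : ℝ) : EReal) := by
      refine iSup_le fun j => EReal.coe_le_coe_iff.2 ?_
      have h2 := hle ⟨_, happend j q hq⟩ z
      rw [chainValue_succ, ← EReal.coe_toReal hz (hbot z), EReal.coe_le_coe_iff] at h2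
      linarith
    rw [← EReal.coe_toReal (hD q hq) (hbot _), EReal.coe_le_coe_iff] at h1
    linarith
  · intro z hz
    have h1 := hlow z
    rwa [← EReal.coe_toReal hz (hbot z), EReal.coe_le_coe_iff] at h1
  · intro q hq
    have h1 := hup q hq
    rwa [← EReal.coe_toReal (hD q hq) (hbot _), EReal.coe_le_coe_iff] at h1

lemma cost_eq_lintegral_ofReal (π : Plan d) :
    cost π = ∫⁻ p, ENNReal.ofReal (dist p.1 p.2 ^ 2) ∂(π : Measure (Rd d × Rd d)) := by
  simp only [cost]
  congr 1 with p
  rw [edist_dist, ENNReal.ofReal_pow dist_nonneg]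

lemma integrable_dist_sq {π : Plan d} (h : cost π ≠ ⊤) :
    Integrable (fun p => dist p.1 p.2 ^ 2) (π : Measure (Rd d × Rd d)) := by
  refine ⟨by fun_prop, ?_⟩
  rw [hasFiniteIntegral_iff_ofReal (ae_of_all _ fun p => by positivity),
    ← cost_eq_lintegral_ofReal]
  exact h.lt_top

lemma cost_eq_ofReal {π : Plan d} (h : cost π ≠ ⊤) :
    cost π = ENNReal.ofReal (∫ p, dist p.1 p.2 ^ 2 ∂(π : Measure (Rd d × Rd d))) := by
  rw [ofReal_integral_eq_lintegral_ofReal (integrable_dist_sq h)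
    (ae_of_all _ fun p => by positivity), cost_eq_lintegral_ofReal]

/-- The integral is the cost of coupling `μ` with the Dirac mass at `y`. -/
lemma integrable_dist_const {μ : Prob d} (hμ : μ ∈ P2 d) (y : Rd d) :
    Integrable (fun x => dist x y ^ 2) (μ : Measure (Rd d)) := by
  let δ : Prob d := ⟨Measure.dirac y, inferInstance⟩
  have hδ : δ ∈ P2 d := by
    change ∫⁻ x, ‖x‖ₑ ^ 2 ∂(Measure.dirac y) < ⊤
    rw [lintegral_dirac' _ (by fun_prop)]
    exact ENNReal.pow_lt_top enorm_lt_top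
  let π : Plan d := push (f := fun x => (x, y)) (by fun_prop) μ
  have hπ : π ∈ couplings μ δ := by
    refine mem_couplings_iff.2 ⟨?_, ?_⟩
    · apply ProbabilityMeasure.toMeasure_injective
      simp only [π, push_push]
      exact Measure.map_id
    · apply ProbabilityMeasure.toMeasure_injective
      simp only [π, push_push]
      simp [Function.comp_def, δ]
  have h := integrable_dist_sq (cost_ne_top hμ hδ hπ)
  exact (integrable_map_measure (by fun_prop) (by fun_prop)).1 h

/-- A plan with cyclically monotone support between measures with finite second moments is
optimal. -/
lemma mem_optCouplings_of_cyclicallyMonotone {μ ν : Prob d} (hμ : μ ∈ P2 d) (hν : ν ∈ P2 d)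
    {π : Plan d} (hπ : π ∈ couplings μ ν)
    (hcm : CyclicallyMonotone (π : Measure (Rd d × Rd d)).support) : π ∈ optCouplings μ ν := by
  refine ⟨hπ, fun π' hπ' => ?_⟩
  obtain ⟨p₀, hp₀⟩ := Measure.nonempty_support (IsProbabilityMeasure.ne_zero
    (π : Measure (Rd d × Rd d)))
  obtain ⟨φ, D, hφ, hD, hΓD, hpot, hlow, hup⟩ := hcm.exists_potential hp₀
  obtain ⟨hπ₁, hπ₂⟩ := mem_couplings_iff.1 hπ
  obtain ⟨hπ'₁, hπ'₂⟩ := mem_couplings_iff.1 hπ'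
  have hcπ := cost_ne_top hμ hν hπ
  have hcπ' := cost_ne_top hμ hν hπ'
  have hsupp : ∀ᵐ p ∂(π : Measure (Rd d × Rd d)),
      p ∈ (π : Measure (Rd d × Rd d)).support := Measure.support_mem_ae
  have hm₁ : Measure.map Prod.fst (π : Measure (Rd d × Rd d)) = μ := hπ.1
  have hm₂ : Measure.map Prod.snd (π : Measure (Rd d × Rd d)) = ν := hπ.2
  have hDμ : ∀ᵐ x ∂(μ : Measure (Rd d)), x ∈ D := by
    rw [← hm₁]
    exact (ae_map_iff measurable_fst.aemeasurable hD).2 (hsupp.mono fun p hp => hΓD p hp)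
  have i₁ : Integrable (fun p : Rd d × Rd d => dist p.1 p₀.2 ^ 2)
      (π : Measure (Rd d × Rd d)) := by
    have := integrable_dist_const hμ p₀.2
    rw [← hm₁] at this
    exact (integrable_map_measure (by fun_prop) (by fun_prop)).1 this
  have i₂ : Integrable (fun p : Rd d × Rd d => dist p₀.1 p.2 ^ 2)
      (π : Measure (Rd d × Rd d)) := by
    have := integrable_dist_const hν p₀.1
    rw [← hm₂] at this
    simpa [Function.comp_def, dist_comm] using
      (integrable_map_measure (by fun_prop) (by fun_prop)).1 this
  have hφπ : AEStronglyMeasurable (fun p : Rd d × Rd d => φ p.1) (π : Measure (Rd d × Rd d)) :=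
    (hφ.comp measurable_fst).aestronglyMeasurable
  -- On the support, `hlow` and `hup` enclose the potential between integrable functions.
  have iφπ : Integrable (fun p : Rd d × Rd d => φ p.1) (π : Measure (Rd d × Rd d)) := by
    refine Integrable.mono' (((integrable_const (dist p₀.1 p₀.2 ^ 2)).add i₁).add
      (i₂.add (integrable_dist_sq hcπ))) hφπ (hsupp.mono fun p hp => ?_)
    have h1 := hlow _ (hΓD p hp)
    have h2 := hup p hp
    simp only [Pi.add_apply, Real.norm_eq_abs]
    rw [abs_le]
    constructor <;> nlinarith [sq_nonneg (dist p₀.1 p₀.2), sq_nonneg (dist p.1 p₀.2),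
      sq_nonneg (dist p₀.1 p.2), sq_nonneg (dist p.1 p.2)]
  have iφ : Integrable φ (μ : Measure (Rd d)) := by
    rw [← hm₁]
    exact (integrable_map_measure (by fun_prop) (by fun_prop)).2 iφπ
  -- Gluing along the second marginal gives triples `(x, y, x')` with `(x, y)` distributed as `π`
  -- and `(x', y)` as `π'`. Integrating the potential inequality between `x` and `x'` compares the
  -- costs: both potential terms equal the integral of `φ` against `μ` and cancel, so no conjugate
  -- potential is needed.
  obtain ⟨Q, hQ, hQ'⟩ := exists_glue (π := π) (π' := push continuous_swap π') (by
    rw [push_push, hπ₂]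
    exact hπ'₂.symm)
  have mp : MeasurePreserving (fun p : Rd d × Rd d × Rd d => (p.1, p.2.1))
      (Q : Measure _) (π : Measure _) := ⟨by fun_prop, congrArg ProbabilityMeasure.toMeasure hQ⟩
  have mp' : MeasurePreserving (fun p : Rd d × Rd d × Rd d => (p.2.2, p.2.1))
      (Q : Measure _) (π' : Measure _) := by
    refine ⟨by fun_prop, ?_⟩
    have h2 : push continuous_swap (push continuous_snd Q) = π' := by
      rw [hQ', push_push]
      apply ProbabilityMeasure.toMeasure_injective
      rw [coe_push]
      convert Measure.map_id
      exact Prod.swap_swap_eq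
    rw [push_push] at h2
    exact congrArg ProbabilityMeasure.toMeasure h2
  have mpμ : MeasurePreserving (Prod.fst : Rd d × Rd d → Rd d) (π : Measure _) (μ : Measure _) :=
    ⟨by fun_prop, hm₁⟩
  have mpμ' : MeasurePreserving (Prod.fst : Rd d × Rd d → Rd d) (π' : Measure _) (μ : Measure _) :=
    ⟨by fun_prop, hπ'.1⟩
  have I₁ := (mp.integrable_comp hφπ).2 iφπ
  have I₂ := (mp.integrable_comp (by fun_prop)).2 (integrable_dist_sq hcπ)
  have I₃ := (mp'.integrable_comp (by fun_prop)).2 (integrable_dist_sq hcπ')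
  have I₄ := ((mpμ'.comp mp').integrable_comp (by fun_prop)).2 iφ
  have hineq : ∀ᵐ p ∂(Q : Measure (Rd d × Rd d × Rd d)),
      φ p.1 + (dist p.1 p.2.1 ^ 2 - dist p.2.2 p.2.1 ^ 2) ≤ φ p.2.2 := by
    have e₁ := mp.quasiMeasurePreserving.ae hsupp
    have e₂ := (mpμ'.comp mp').quasiMeasurePreserving.ae hDμ
    filter_upwards [e₁, e₂] with p h1 h2 using hpot _ h1 _ h2
  have hint := integral_mono_ae (I₁.add (I₂.sub I₃)) I₄ hineq
  rw [integral_add' I₁ (I₂.sub I₃), integral_sub' I₂ I₃] at hint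
  have E₁ : ∫ p, ((fun p : Rd d × Rd d => φ p.1) ∘ fun p : Rd d × Rd d × Rd d => (p.1, p.2.1)) p
      ∂(Q : Measure _) = ∫ x, φ x ∂(μ : Measure _) := by
    rw [← (mpμ.comp mp).map_eq, integral_map (by fun_prop) (by fun_prop)]
    rfl
  have E₄ : ∫ p, (φ ∘ (Prod.fst ∘ fun p : Rd d × Rd d × Rd d => (p.2.2, p.2.1))) p
      ∂(Q : Measure _) = ∫ x, φ x ∂(μ : Measure _) := by
    rw [← (mpμ'.comp mp').map_eq, integral_map (by fun_prop) (by fun_prop)]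
    rfl
  have E₂ : ∫ p, ((fun p : Rd d × Rd d => dist p.1 p.2 ^ 2) ∘
      fun p : Rd d × Rd d × Rd d => (p.1, p.2.1)) p ∂(Q : Measure _) =
      ∫ p, dist p.1 p.2 ^ 2 ∂(π : Measure (Rd d × Rd d)) := by
    rw [← mp.map_eq, integral_map (by fun_prop) (by fun_prop)]
    rfl
  have E₃ : ∫ p, ((fun p : Rd d × Rd d => dist p.1 p.2 ^ 2) ∘
      fun p : Rd d × Rd d × Rd d => (p.2.2, p.2.1)) p ∂(Q : Measure _) =
      ∫ p, dist p.1 p.2 ^ 2 ∂(π' : Measure (Rd d × Rd d)) := by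
    rw [← mp'.map_eq, integral_map (by fun_prop) (by fun_prop)]
    rfl
  rw [E₁, E₂, E₃, E₄] at hint
  rw [cost_eq_ofReal hcπ, cost_eq_ofReal hcπ']
  exact ENNReal.ofReal_le_ofReal (by linarith)

end Potential

/-! ### Barycenters as midpoint laws of optimal plans -/

section Barycenters

variable {d : ℕ}

lemma P2_of_secondMoment_le {M : ℝ≥0∞} (hM : M ≠ ⊤) {μ : Prob d} (h : secondMoment μ ≤ M) :
    μ ∈ P2 d :=
  mem_P2_iff.2 (h.trans_lt hM.lt_top)

/-- Optimal plans whose marginals have second moment at most `M`. -/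
def optBall (d : ℕ) (M : ℝ≥0∞) : Set (Plan d) :=
  {π | π ∈ planBall d M ∧ π ∈ optCouplings (push continuous_fst π) (push continuous_snd π)}

lemma mem_optBall_iff {M : ℝ≥0∞} {μ ν : Prob d} (hμ : secondMoment μ ≤ M)
    (hν : secondMoment ν ≤ M) {π : Plan d} :
    π ∈ optCouplings μ ν ↔
      π ∈ optBall d M ∧ push continuous_fst π = μ ∧ push continuous_snd π = ν := by
  constructor
  · intro h
    obtain ⟨rfl, rfl⟩ := mem_couplings_iff.1 h.1
    exact ⟨⟨⟨hμ, hν⟩, h⟩, rfl, rfl⟩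
  · rintro ⟨h, rfl, rfl⟩
    exact h.2

/-- Optimality of plans is stable under weak convergence with bounded second moments. -/
lemma isCompact_optBall {M : ℝ≥0∞} (hM : M ≠ ⊤) : IsCompact (optBall d M) := by
  have hball := isCompact_planBall (d := d) hM
  refine hball.of_isClosed_subset ?_ fun π h => h.1
  refine isClosed_of_closure_subset fun π hπ => ?_
  have hπball : π ∈ planBall d M :=
    closure_minimal (fun π h => h.1) hball.isClosed hπ
  refine ⟨hπball, mem_optCouplings_of_cyclicallyMonotone (P2_of_secondMoment_le hM hπball.1)
    (P2_of_secondMoment_le hM hπball.2) (mem_couplings_iff.2 ⟨rfl, rfl⟩) ?_⟩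
  refine cyclicallyMonotone_support_of_mem_closure (closure_mono ?_ hπ)
  exact fun θ hθ => ⟨_, _, hθ.2, cost_ne_top (P2_of_secondMoment_le hM hθ.1.1)
    (P2_of_secondMoment_le hM hθ.1.2) hθ.2.1⟩

lemma continuous_half_add_half :
    Continuous fun p : Rd d × Rd d => (1 / 2 : ℝ) • p.1 + (1 / 2 : ℝ) • p.2 := by
  fun_prop

/-- The midpoint measure of a plan. -/
noncomputable def midLaw (π : Plan d) : Prob d := push continuous_half_add_half π

@[fun_prop] lemma continuous_midLaw : Continuous (midLaw : Plan d → Prob d) :=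
  continuous_push continuous_half_add_half

lemma secondMoment_midLaw_le (π : Plan d) :
    secondMoment (midLaw π) ≤
      secondMoment (push continuous_fst π) + secondMoment (push continuous_snd π) := by
  refine (secondMoment_push_le _ (fun p => ?_) π).trans (secondMoment_prod_le π)
  rw [enorm_eq_nnnorm, enorm_eq_nnnorm, ENNReal.coe_le_coe, ← NNReal.coe_le_coe, coe_nnnorm,
    coe_nnnorm]
  refine (norm_add_le _ _).trans ?_
  rw [norm_smul, norm_smul]
  have h1 := norm_fst_le p
  have h2 := norm_snd_le p
  norm_num
  linarith

lemma midLaw_mem_P2 {μ ν : Prob d} (hμ : μ ∈ P2 d) (hν : ν ∈ P2 d) {π : Plan d}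
    (hπ : π ∈ couplings μ ν) : midLaw π ∈ P2 d := by
  obtain ⟨rfl, rfl⟩ := mem_couplings_iff.1 hπ
  rw [mem_P2_iff] at *
  exact (secondMoment_midLaw_le π).trans_lt (ENNReal.add_lt_top.2 ⟨hμ, hν⟩)

/-- The parallelogram law for `z - x` and `z - y`. -/
lemma half_edist_sq_add (x y z : Rd d) :
    (1 / 2) * edist z x ^ 2 + (1 / 2) * edist z y ^ 2 =
      edist z ((1 / 2 : ℝ) • x + (1 / 2 : ℝ) • y) ^ 2 + (1 / 4) * edist x y ^ 2 := by
  have h2 : (1 / 2 : ℝ≥0∞) = ENNReal.ofReal (1 / 2) := by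
    rw [ENNReal.ofReal_div_of_pos (by norm_num)]; simp
  have h4 : (1 / 4 : ℝ≥0∞) = ENNReal.ofReal (1 / 4) := by
    rw [ENNReal.ofReal_div_of_pos (by norm_num)]; simp
  simp only [edist_dist, ← ENNReal.ofReal_pow dist_nonneg, h2, h4]
  rw [← ENNReal.ofReal_mul (by norm_num), ← ENNReal.ofReal_mul (by norm_num),
    ← ENNReal.ofReal_mul (by norm_num), ← ENNReal.ofReal_add (by positivity) (by positivity),
    ← ENNReal.ofReal_add (by positivity) (by positivity)]
  congr 1
  have hp := parallelogram_law_with_norm ℝ (z - x) (z - y)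
  have e1 : dist z ((1 / 2 : ℝ) • x + (1 / 2 : ℝ) • y) = 1 / 2 * ‖z - x + (z - y)‖ := by
    rw [dist_eq_norm, show z - ((1 / 2 : ℝ) • x + (1 / 2 : ℝ) • y) =
      (1 / 2 : ℝ) • (z - x + (z - y)) by module, norm_smul]
    norm_num
  have e2 : ‖z - x - (z - y)‖ = dist x y := by
    rw [dist_comm, dist_eq_norm]
    congr 1
    abel
  rw [e1, dist_eq_norm z x, dist_eq_norm z y]
  rw [e2] at hp
  nlinarith

/-- Gluing along `ρ` makes the pointwise identity `half_edist_sq_add` integrable term by term: the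
barycenter cost splits into the deviation of `ρ` from the midpoint and a quarter of the cost of a
plan from `μ` to `ν`. -/
lemma exists_glue_cost {ρ μ ν : Prob d} {γ γ' : Plan d} (h : γ ∈ couplings ρ μ)
    (h' : γ' ∈ couplings ρ ν) :
    ∃ Q : ProbabilityMeasure (Rd d × Rd d × Rd d),
      push (f := fun p => p.2.1) (by fun_prop) Q = ρ ∧
      push (f := fun p => (p.1, p.2.2)) (by fun_prop) Q ∈ couplings μ ν ∧
      (1 / 2) * cost γ + (1 / 2) * cost γ' =
        ∫⁻ p, edist p.2.1 ((1 / 2 : ℝ) • p.1 + (1 / 2 : ℝ) • p.2.2) ^ 2 ∂(Q : Measure (Rd d × Rd d × Rd d)) +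
          (1 / 4) * cost (push (f := fun p => (p.1, p.2.2)) (by fun_prop) Q) := by
  obtain ⟨hγ₁, hγ₂⟩ := mem_couplings_iff.1 (swap_mem_couplings h)
  obtain ⟨hγ'₁, hγ'₂⟩ := mem_couplings_iff.1 h'
  obtain ⟨Q, hQ, hQ'⟩ := exists_glue (hγ₂.trans hγ'₁.symm)
  refine ⟨Q, ?_, mem_couplings_iff.2 ⟨?_, ?_⟩, ?_⟩
  · rw [← hγ₂, ← hQ, push_push]
  · rw [← hγ₁, ← hQ, push_push, push_push]
  · rw [← hγ'₂, ← hQ', push_push, push_push]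
  · rw [← cost_swap γ, ← hQ, ← hQ', cost_push, cost_push, cost_push,
      ← lintegral_const_mul _ (by fun_prop), ← lintegral_const_mul _ (by fun_prop),
      ← lintegral_const_mul _ (by fun_prop), ← lintegral_add_left (by fun_prop),
      ← lintegral_add_left (by fun_prop)]
    congr 1 with p
    rw [edist_comm p.1 p.2.1]
    exact half_edist_sq_add p.1 p.2.2 p.2.1

lemma quarter_W2sq_le {μ ν : Prob d} (hμ : μ ∈ P2 d) (hν : ν ∈ P2 d) (ρ : Prob d) :
    (1 / 4) * W2sq μ ν ≤ (1 / 2) * W2sq ρ μ + (1 / 2) * W2sq ρ ν := by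
  by_cases hρ : W2sq ρ μ = ⊤
  · simp [hρ, ENNReal.mul_top]
  have hρ2 : ρ ∈ P2 d := mem_P2_of_W2sq_ne_top hμ (by rwa [W2sq_comm])
  obtain ⟨γ, hγ⟩ := optCouplings_nonempty hρ2 hμ
  obtain ⟨γ', hγ'⟩ := optCouplings_nonempty hρ2 hν
  obtain ⟨Q, -, hQ, hc⟩ := exists_glue_cost hγ.1 hγ'.1
  rw [← optCouplings_cost hγ, ← optCouplings_cost hγ', hc]
  exact le_add_left (by gcongr; exact W2sq_le hQ)

/-- At the midpoint the deviation term vanishes. With `quarter_W2sq_le` this identifies the minimal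
barycenter cost. -/
lemma W2sq_midLaw_le {μ ν : Prob d} {π : Plan d} (hπ : π ∈ optCouplings μ ν) :
    (1 / 2) * W2sq (midLaw π) μ + (1 / 2) * W2sq (midLaw π) ν ≤ (1 / 4) * W2sq μ ν := by
  obtain ⟨h₁, h₂⟩ := mem_couplings_iff.1 hπ.1
  let γ : Plan d := push (f := fun p : Rd d × Rd d =>
    ((1 / 2 : ℝ) • p.1 + (1 / 2 : ℝ) • p.2, p.1)) (by fun_prop) π
  let γ' : Plan d := push (f := fun p : Rd d × Rd d =>
    ((1 / 2 : ℝ) • p.1 + (1 / 2 : ℝ) • p.2, p.2)) (by fun_prop) π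
  have hγ : γ ∈ couplings (midLaw π) μ :=
    mem_couplings_iff.2 ⟨by rw [push_push]; rfl, by rw [push_push]; exact h₁⟩
  have hγ' : γ' ∈ couplings (midLaw π) ν :=
    mem_couplings_iff.2 ⟨by rw [push_push]; rfl, by rw [push_push]; exact h₂⟩
  calc (1 / 2) * W2sq (midLaw π) μ + (1 / 2) * W2sq (midLaw π) ν
      ≤ (1 / 2) * cost γ + (1 / 2) * cost γ' := by
        gcongr
        · exact W2sq_le hγ
        · exact W2sq_le hγ'
    _ = (1 / 4) * cost π := by
        rw [cost_push, cost_push, cost, ← lintegral_const_mul _ (by fun_prop),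
          ← lintegral_const_mul _ (by fun_prop), ← lintegral_const_mul _ (by fun_prop),
          ← lintegral_add_left (by fun_prop)]
        congr 1 with p
        simpa using half_edist_sq_add p.1 p.2 ((1 / 2 : ℝ) • p.1 + (1 / 2 : ℝ) • p.2)
    _ = _ := by rw [optCouplings_cost hπ]

/-- The barycenters are the midpoint measures of optimal plans. -/
lemma Bar_eq_image {μ ν : Prob d} (hμ : μ ∈ P2 d) (hν : ν ∈ P2 d) :
    Bar μ ν = midLaw '' optCouplings μ ν := by
  ext β
  constructor
  · intro hβ
    obtain ⟨π₀, hπ₀⟩ := optCouplings_nonempty hμ hν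
    have hle := (hβ (midLaw π₀)).trans (W2sq_midLaw_le hπ₀)
    have hfin : (1 / 4) * W2sq μ ν ≠ ⊤ := ENNReal.mul_ne_top (by simp) (W2sq_ne_top hμ hν)
    have hβμ : W2sq β μ ≠ ⊤ := by
      intro h
      rw [h] at hle
      simp [ENNReal.mul_top] at hle
      exact hfin (by simpa using hle)
    have hβ2 : β ∈ P2 d := mem_P2_of_W2sq_ne_top hμ (by rwa [W2sq_comm])
    obtain ⟨γ, hγ⟩ := optCouplings_nonempty hβ2 hμ
    obtain ⟨γ', hγ'⟩ := optCouplings_nonempty hβ2 hν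
    obtain ⟨Q, hQβ, hQ, hc⟩ := exists_glue_cost hγ.1 hγ'.1
    rw [← optCouplings_cost hγ, ← optCouplings_cost hγ', hc] at hle
    have hfinQ := cost_ne_top hμ hν hQ
    have h14 : (1 / 4 : ℝ≥0∞) ≠ 0 := by simp
    have h14' : (1 / 4 : ℝ≥0∞) ≠ ⊤ := by simp
    refine ⟨_, mem_optCouplings_iff.2 ⟨hQ, ?_⟩, ?_⟩
    · exact (ENNReal.mul_le_mul_iff_right h14 h14').1 (le_add_self.trans hle)
    · have hle' := hle.trans (mul_le_mul_right (W2sq_le hQ) (1 / 4))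
      -- The minimal value already pays for the plan from `μ` to `ν`, so nothing is left for the
      -- deviation: the middle point is almost surely the midpoint.
      have hzero : ∫⁻ p, edist p.2.1 ((1 / 2 : ℝ) • p.1 + (1 / 2 : ℝ) • p.2.2) ^ 2
          ∂(Q : Measure (Rd d × Rd d × Rd d)) = 0 := by
        rw [← nonpos_iff_eq_zero]
        refine (ENNReal.add_le_add_iff_right (ENNReal.mul_ne_top h14' hfinQ)).1 ?_
        rw [zero_add]
        exact hle'
      rw [lintegral_eq_zero_iff (by fun_prop)] at hzero
      rw [← hQβ, midLaw, push_push]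
      apply ProbabilityMeasure.toMeasure_injective
      refine Measure.map_congr (hzero.mono fun p hp => ?_)
      simp only [Pi.zero_apply, pow_eq_zero_iff, ne_eq, OfNat.ofNat_ne_zero, not_false_eq_true,
        edist_eq_zero] at hp
      exact hp.symm
  · rintro ⟨π, hπ, rfl⟩ ρ
    exact (W2sq_midLaw_le hπ).trans (quarter_W2sq_le hμ hν ρ)

lemma W2sqSet_Bar {μ ν ρ : Prob d} (hμ : μ ∈ P2 d) (hρ : ρ ∈ P2 d) :
    W2sqSet ν (Bar μ ρ) = ⨅ π ∈ optCouplings μ ρ, W2sq ν (midLaw π) := by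
  rw [Bar_eq_image hμ hρ, W2sqSet, iInf_image]

/-- The midpoint measure of the first and third marginal. -/
noncomputable def midLaw₃ (Q : ProbabilityMeasure (Rd d × Rd d × Rd d)) : Prob d :=
  push (f := fun p => (1 / 2 : ℝ) • p.1 + (1 / 2 : ℝ) • p.2.2) (by fun_prop) Q

@[fun_prop] lemma continuous_midLaw₃ :
    Continuous (midLaw₃ : ProbabilityMeasure (Rd d × Rd d × Rd d) → Prob d) := by
  unfold midLaw₃
  exact continuous_push _

lemma midLaw₃_eq (Q : ProbabilityMeasure (Rd d × Rd d × Rd d)) :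
    midLaw₃ Q = midLaw (push (f := fun p => (p.1, p.2.2)) (by fun_prop) Q) := by
  rw [midLaw, push_push]
  rfl

lemma W2sqSet_GenBar (μ ν ρ : Prob d) :
    W2sqSet ν (GenBar ν μ ρ) = ⨅ Q ∈ optCouplings₃ μ ν ρ, W2sq ν (midLaw₃ Q) := by
  have : GenBar ν μ ρ = midLaw₃ '' optCouplings₃ μ ν ρ := rfl
  rw [this, W2sqSet, iInf_image]

lemma W2sqSet_Bar_ne_top {μ ν ρ : Prob d} (hμ : μ ∈ P2 d) (hν : ν ∈ P2 d) (hρ : ρ ∈ P2 d) :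
    W2sqSet ν (Bar μ ρ) ≠ ⊤ := by
  obtain ⟨π, hπ⟩ := optCouplings_nonempty hμ hρ
  rw [W2sqSet_Bar hμ hρ]
  exact ne_top_of_le_ne_top (W2sq_ne_top hν (midLaw_mem_P2 hμ hρ hπ.1)) (iInf₂_le π hπ)

lemma W2sqSet_GenBar_ne_top {μ ν ρ : Prob d} (hμ : μ ∈ P2 d) (hν : ν ∈ P2 d) (hρ : ρ ∈ P2 d) :
    W2sqSet ν (GenBar ν μ ρ) ≠ ⊤ := by
  obtain ⟨π, hπ⟩ := optCouplings_nonempty hμ hν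
  obtain ⟨π', hπ'⟩ := optCouplings_nonempty hν hρ
  obtain ⟨h₁, h₂⟩ := mem_couplings_iff.1 hπ.1
  obtain ⟨h'₁, h'₂⟩ := mem_couplings_iff.1 hπ'.1
  obtain ⟨Q, hQ, hQ'⟩ := exists_glue (h₂.trans h'₁.symm)
  have hmem : Q ∈ optCouplings₃ μ ν ρ := by
    subst hQ hQ'
    exact ⟨hπ, hπ'⟩
  rw [W2sqSet_GenBar]
  refine ne_top_of_le_ne_top (W2sq_ne_top hν ?_) (iInf₂_le Q hmem)
  rw [midLaw₃_eq]
  refine midLaw_mem_P2 hμ hρ (mem_couplings_iff.2 ⟨?_, ?_⟩)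
  · rw [← h₁, ← hQ, push_push, push_push]
  · rw [← h'₂, ← hQ', push_push, push_push]

end Barycenters

/-! ### Lower semicontinuity and finiteness of the energies -/

section LowerSemicontinuity

lemma lowerSemicontinuousOn_comp {A B : Type*} [TopologicalSpace A] [TopologicalSpace B]
    {f : B → ℝ≥0∞} {t : Set B} (hf : LowerSemicontinuousOn f t) {g : A → B} (hg : Continuous g)
    {s : Set A} (hst : Set.MapsTo g s t) : LowerSemicontinuousOn (fun a => f (g a)) s :=
  fun x hx y hy => (hg.continuousWithinAt.tendsto_nhdsWithin hst).eventually (hf (g x) (hst hx) y hy)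

lemma lowerSemicontinuousOn_of_eqOn {A : Type*} [TopologicalSpace A] {f g : A → ℝ≥0∞} {s : Set A}
    (hg : LowerSemicontinuous g) (h : ∀ x ∈ s, f x = g x) : LowerSemicontinuousOn f s := by
  intro x hx y hy
  simp only [h x hx] at hy
  filter_upwards [nhdsWithin_le_nhds (hg x y hy), self_mem_nhdsWithin] with z hz hzs
  simpa only [h z hzs] using hz

variable {d : ℕ}

/-- Measures with second moment at most `M`. -/
def momentBall (d : ℕ) (M : ℝ≥0∞) : Set (Prob d) := {μ | secondMoment μ ≤ M}

lemma isCompact_momentBall {M : ℝ≥0∞} (hM : M ≠ ⊤) : IsCompact (momentBall d M) :=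
  isCompact_secondMoment_le hM

lemma mem_P2_of_mem_momentBall {M : ℝ≥0∞} (hM : M ≠ ⊤) {μ : Prob d} (h : μ ∈ momentBall d M) :
    μ ∈ P2 d :=
  P2_of_secondMoment_le hM h

/-- For marginals in the moment ball, the couplings are a whole fibre of the marginal map on the
compact set `planBall d M`. -/
lemma lowerSemicontinuousOn_W2sq {M : ℝ≥0∞} (hM : M ≠ ⊤) :
    LowerSemicontinuousOn (fun p : Prob d × Prob d => W2sq p.1 p.2)
      (momentBall d M ×ˢ momentBall d M) := by
  have hp : Continuous fun π : Plan d => (push continuous_fst π, push continuous_snd π) := by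
    fun_prop
  refine lowerSemicontinuousOn_of_eqOn (lowerSemicontinuous_iInf_fiber
    (isCompact_planBall (d := d) hM) hp (lowerSemicontinuous_cost.lowerSemicontinuousOn _)) ?_
  rintro ⟨μ, ν⟩ ⟨hμ, hν⟩
  have : {π | π ∈ planBall d M ∧ (push continuous_fst π, push continuous_snd π) = (μ, ν)} =
      couplings μ ν := by
    ext π
    rw [mem_couplings_iff, Set.mem_ofPred_eq, Prod.mk.injEq, and_iff_right_iff_imp]
    rintro ⟨rfl, rfl⟩
    exact ⟨hμ, hν⟩
  rw [this]
  rfl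

/-- Three-measure couplings with optimal consecutive marginals and bounded second moments. -/
def optBall₃ (d : ℕ) (M : ℝ≥0∞) : Set (ProbabilityMeasure (Rd d × Rd d × Rd d)) :=
  {Q | push (f := fun p => (p.1, p.2.1)) (by fun_prop) Q ∈ optBall d M ∧
    push continuous_snd Q ∈ optBall d M}

lemma isCompact_optBall₃ {M : ℝ≥0∞} (hM : M ≠ ⊤) : IsCompact (optBall₃ d M) := by
  refine (isCompact_secondMoment_le (M := M + (M + M)) (by simp [hM])).of_isClosed_subset
    (((isCompact_optBall hM).isClosed.preimage (continuous_push _)).inter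
      ((isCompact_optBall hM).isClosed.preimage (continuous_push _))) ?_
  rintro Q ⟨h, h'⟩
  refine (secondMoment_prod_le Q).trans (add_le_add ?_ ((secondMoment_prod_le _).trans
    (add_le_add h'.1.1 h'.1.2)))
  have := h.1.1
  rw [push_push] at this
  exact this

lemma lowerSemicontinuousOn_W2sqSet_Bar {M : ℝ≥0∞} (hM : M ≠ ⊤) :
    LowerSemicontinuousOn (fun t : Prob d × Prob d × Prob d => W2sqSet t.2.1 (Bar t.1 t.2.2))
      (momentBall d M ×ˢ momentBall d M ×ˢ momentBall d M) := by
  have hp : Continuous fun a : Prob d × Plan d =>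
      (push continuous_fst a.2, a.1, push continuous_snd a.2) := by
    fun_prop
  have hg : Continuous fun a : Prob d × Plan d => (a.1, midLaw a.2) := by fun_prop
  -- A midpoint law is only bounded by the sum of the two marginal moments, hence the radius `M +
  -- M`.
  have hmaps : Set.MapsTo (fun a : Prob d × Plan d => (a.1, midLaw a.2))
      (momentBall d M ×ˢ optBall d M) (momentBall d (M + M) ×ˢ momentBall d (M + M)) := by
    rintro ⟨ν, π⟩ ⟨hν, hπ⟩
    exact ⟨(show secondMoment ν ≤ M from hν).trans le_self_add, (secondMoment_midLaw_le π).trans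
      (add_le_add hπ.1.1 hπ.1.2)⟩
  refine lowerSemicontinuousOn_of_eqOn (lowerSemicontinuous_iInf_fiber
    ((isCompact_momentBall hM).prod (isCompact_optBall hM)) hp
    (lowerSemicontinuousOn_comp (lowerSemicontinuousOn_W2sq (by simp [hM])) hg hmaps)) ?_
  rintro ⟨μ, ν, ρ⟩ ⟨hμ, hν, hρ⟩
  simp only at hμ hν hρ ⊢
  rw [W2sqSet_Bar (mem_P2_of_mem_momentBall hM hμ) (mem_P2_of_mem_momentBall hM hρ)]
  refine le_antisymm (le_iInf₂ ?_) (le_iInf₂ fun π hπ => ?_)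
  · rintro ⟨ν', π⟩ ⟨⟨-, hπ⟩, h⟩
    simp only [Prod.mk.injEq] at h
    obtain ⟨h₁, rfl, h₂⟩ := h
    exact iInf₂_le π ((mem_optBall_iff hμ hρ).2 ⟨hπ, h₁, h₂⟩)
  · obtain ⟨hb, rfl, rfl⟩ := (mem_optBall_iff hμ hρ).1 hπ
    exact iInf₂_le (ν, π) ⟨⟨hν, hb⟩, rfl⟩

lemma mem_optCouplings₃_iff {μ ν ρ : Prob d} {Q : ProbabilityMeasure (Rd d × Rd d × Rd d)} :
    Q ∈ optCouplings₃ μ ν ρ ↔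
      push (f := fun p => (p.1, p.2.1)) (by fun_prop) Q ∈ optCouplings μ ν ∧
      push continuous_snd Q ∈ optCouplings ν ρ :=
  Iff.rfl

/-- Here the base point is itself a marginal of the three-measure coupling, so the fibre infimum
runs over `optBall₃` alone. -/
lemma lowerSemicontinuousOn_W2sqSet_GenBar {M : ℝ≥0∞} (hM : M ≠ ⊤) :
    LowerSemicontinuousOn
      (fun t : Prob d × Prob d × Prob d => W2sqSet t.2.1 (GenBar t.2.1 t.1 t.2.2))
      (momentBall d M ×ˢ momentBall d M ×ˢ momentBall d M) := by
  have hp : Continuous fun Q : ProbabilityMeasure (Rd d × Rd d × Rd d) =>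
      (push continuous_fst Q, push (continuous_fst.comp continuous_snd) Q,
        push (continuous_snd.comp continuous_snd) Q) := by
    fun_prop
  have hg : Continuous fun Q : ProbabilityMeasure (Rd d × Rd d × Rd d) =>
      (push (continuous_fst.comp continuous_snd) Q, midLaw₃ Q) := by
    fun_prop
  have hmaps : Set.MapsTo (fun Q : ProbabilityMeasure (Rd d × Rd d × Rd d) =>
      (push (continuous_fst.comp continuous_snd) Q, midLaw₃ Q))
      (optBall₃ d M) (momentBall d (M + M) ×ˢ momentBall d (M + M)) := by
    rintro Q ⟨h, h'⟩
    have h₁ := h.1.1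
    have h₂ := h'.1.1
    have h₃ := h'.1.2
    rw [push_push] at h₁ h₂ h₃
    refine ⟨h₂.trans le_self_add, ?_⟩
    simp only [momentBall, Set.mem_ofPred_eq]
    rw [midLaw₃_eq]
    refine (secondMoment_midLaw_le _).trans (add_le_add ?_ ?_)
    · rw [push_push]
      exact h₁
    · rw [push_push]
      exact h₃
  refine lowerSemicontinuousOn_of_eqOn (lowerSemicontinuous_iInf_fiber
    (isCompact_optBall₃ hM) hp
    (lowerSemicontinuousOn_comp (lowerSemicontinuousOn_W2sq (by simp [hM])) hg hmaps)) ?_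
  rintro ⟨μ, ν, ρ⟩ ⟨hμ, hν, hρ⟩
  simp only at hμ hν hρ ⊢
  rw [W2sqSet_GenBar]
  refine le_antisymm (le_iInf₂ ?_) (le_iInf₂ fun Q hQ => ?_)
  · rintro Q ⟨⟨h, h'⟩, hQ⟩
    simp only [Prod.mk.injEq] at hQ
    obtain ⟨h₁, h₂, h₃⟩ := hQ
    have hmem : Q ∈ optCouplings₃ μ ν ρ := mem_optCouplings₃_iff.2
      ⟨(mem_optBall_iff hμ hν).2 ⟨h, by rw [push_push]; exact h₁, by rw [push_push]; exact h₂⟩,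
        (mem_optBall_iff hν hρ).2 ⟨h', by rw [push_push]; exact h₂, by rw [push_push]; exact h₃⟩⟩
    exact (iInf₂_le Q hmem).trans (by rw [h₂])
  · rw [mem_optCouplings₃_iff] at hQ
    obtain ⟨h, h₁, h₂⟩ := (mem_optBall_iff hμ hν).1 hQ.1
    obtain ⟨h', h'₁, h'₂⟩ := (mem_optBall_iff hν hρ).1 hQ.2
    rw [push_push] at h₁ h₂ h'₂
    have e₁ : push continuous_fst Q = μ := h₁
    have e₂ : push (continuous_fst.comp continuous_snd) Q = ν := h₂
    have e₃ : push (continuous_snd.comp continuous_snd) Q = ρ := h'₂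
    refine (iInf₂_le Q ⟨⟨h, h'⟩, ?_⟩).trans (by rw [e₂])
    rw [e₁, e₂, e₃]

/-- Tuples of measures with second moment at most `M`. -/
def tupleBall (d n : ℕ) (M : ℝ≥0∞) : Set (Fin n → Prob d) := {μ | ∀ k, secondMoment (μ k) ≤ M}

lemma isCompact_tupleBall {n : ℕ} {M : ℝ≥0∞} (hM : M ≠ ⊤) : IsCompact (tupleBall d n M) :=
  isCompact_pi_infinite fun _ => isCompact_momentBall hM

lemma lowerSemicontinuousOn_const_mul {A : Type*} [TopologicalSpace A] {f : A → ℝ≥0∞} {s : Set A}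
    (hf : LowerSemicontinuousOn f s) {c : ℝ≥0∞} (hc : c ≠ ⊤) :
    LowerSemicontinuousOn (fun a => c * f a) s :=
  (ENNReal.continuous_const_mul hc).comp_lowerSemicontinuousOn hf
    fun _ _ h => mul_le_mul_right h c

lemma lowerSemicontinuousOn_pathEnergy (K n : ℕ) {M : ℝ≥0∞} (hM : M ≠ ⊤) :
    LowerSemicontinuousOn (pathEnergy (d := d) K (n := n)) (tupleBall d (n + 1) M) := by
  refine lowerSemicontinuousOn_const_mul (lowerSemicontinuousOn_sum fun k _ => ?_) (by simp)
  exact lowerSemicontinuousOn_comp (lowerSemicontinuousOn_W2sq hM)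
    (g := fun μ : Fin (n + 1) → Prob d => (μ k.castSucc, μ k.succ)) (by fun_prop)
    fun μ hμ => ⟨hμ _, hμ _⟩

lemma four_mul_pow_ne_top (K : ℕ) : 4 * (K : ℝ≥0∞) ^ 3 ≠ ⊤ :=
  ENNReal.mul_ne_top (by simp) (ENNReal.pow_ne_top (by simp))

lemma lowerSemicontinuousOn_splineEnergy (K n : ℕ) {M : ℝ≥0∞} (hM : M ≠ ⊤) :
    LowerSemicontinuousOn (splineEnergy (d := d) K (n := n)) (tupleBall d (n + 1) M) := by
  refine lowerSemicontinuousOn_const_mul (lowerSemicontinuousOn_sum fun j _ => ?_)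
    (four_mul_pow_ne_top K)
  exact lowerSemicontinuousOn_comp (lowerSemicontinuousOn_W2sqSet_Bar hM)
    (g := fun μ : Fin (n + 1) → Prob d =>
      (μ ⟨j, by omega⟩, μ ⟨j + 1, by omega⟩, μ ⟨j + 2, by omega⟩)) (by fun_prop)
    fun μ hμ => ⟨hμ _, hμ _, hμ _⟩

lemma lowerSemicontinuousOn_genSplineEnergy (K n : ℕ) {M : ℝ≥0∞} (hM : M ≠ ⊤) :
    LowerSemicontinuousOn (genSplineEnergy (d := d) K (n := n)) (tupleBall d (n + 1) M) := by
  refine lowerSemicontinuousOn_const_mul (lowerSemicontinuousOn_sum fun j _ => ?_)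
    (four_mul_pow_ne_top K)
  exact lowerSemicontinuousOn_comp (lowerSemicontinuousOn_W2sqSet_GenBar hM)
    (g := fun μ : Fin (n + 1) → Prob d =>
      (μ ⟨j, by omega⟩, μ ⟨j + 1, by omega⟩, μ ⟨j + 2, by omega⟩)) (by fun_prop)
    fun μ hμ => ⟨hμ _, hμ _, hμ _⟩

lemma pathEnergy_ne_top (K : ℕ) {n : ℕ} {μ : Fin (n + 1) → Prob d} (hμ : ∀ k, μ k ∈ P2 d) :
    pathEnergy K μ ≠ ⊤ :=
  ENNReal.mul_ne_top (by simp) (ENNReal.sum_ne_top.2 fun _ _ => W2sq_ne_top (hμ _) (hμ _))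

lemma splineEnergy_ne_top (K : ℕ) {n : ℕ} {μ : Fin (n + 1) → Prob d} (hμ : ∀ k, μ k ∈ P2 d) :
    splineEnergy K μ ≠ ⊤ :=
  ENNReal.mul_ne_top (four_mul_pow_ne_top K)
    (ENNReal.sum_ne_top.2 fun _ _ => W2sqSet_Bar_ne_top (hμ _) (hμ _) (hμ _))

lemma genSplineEnergy_ne_top (K : ℕ) {n : ℕ} {μ : Fin (n + 1) → Prob d} (hμ : ∀ k, μ k ∈ P2 d) :
    genSplineEnergy K μ ≠ ⊤ :=
  ENNReal.mul_ne_top (four_mul_pow_ne_top K)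
    (ENNReal.sum_ne_top.2 fun _ _ => W2sqSet_GenBar_ne_top (hμ _) (hμ _) (hμ _))

end LowerSemicontinuity

/-! ### Moment bounds, compactness of constraints, and the direct method -/

section Existence

variable {d : ℕ}

/-- Bounds on consecutive distances propagate a moment bound along a tuple. -/
lemma exists_moment_bound {n : ℕ} (k₀ : Fin (n + 1)) {A B : ℝ≥0∞} (hA : A ≠ ⊤) (hB : B ≠ ⊤) :
    ∃ M : ℝ≥0∞, M ≠ ⊤ ∧ ∀ μ : Fin (n + 1) → Prob d, secondMoment (μ k₀) ≤ B →
      (∀ k : Fin n, W2sq (μ k.castSucc) (μ k.succ) ≤ A) → μ ∈ tupleBall d (n + 1) M := by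
  let S : Set (Fin (n + 1) → Prob d) :=
    {μ | secondMoment (μ k₀) ≤ B ∧ ∀ k : Fin n, W2sq (μ k.castSucc) (μ k.succ) ≤ A}
  let bdd : Fin (n + 1) → Prop := fun k => ∃ M : ℝ≥0∞, M ≠ ⊤ ∧ ∀ μ ∈ S, secondMoment (μ k) ≤ M
  -- An equivalence is needed because `k₀` may lie anywhere: the bound travels from `k₀` down to `0`
  -- and from there to every index.
  have hstep : ∀ k : Fin n, bdd k.castSucc ↔ bdd k.succ := by
    intro k
    constructor
    · rintro ⟨M, hM, h⟩
      refine ⟨4 * M + 4 * A, by finiteness, fun μ hμ =>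
        (secondMoment_le_W2sq (μ k.castSucc) (μ k.succ)).trans ?_⟩
      gcongr
      · exact h μ hμ
      · exact hμ.2 k
    · rintro ⟨M, hM, h⟩
      refine ⟨4 * M + 4 * A, by finiteness, fun μ hμ =>
        (secondMoment_le_W2sq (μ k.succ) (μ k.castSucc)).trans ?_⟩
      rw [W2sq_comm]
      gcongr
      · exact h μ hμ
      · exact hμ.2 k
  have hzero : ∀ k, bdd k ↔ bdd 0 := fun k => by
    induction k using Fin.induction with
    | zero => rfl
    | succ k ih => rw [← hstep k, ih]
  have hall : ∀ k, bdd k := fun k => by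
    rw [hzero k, ← hzero k₀]
    exact ⟨B, hB, fun μ hμ => hμ.1⟩
  choose M hM hb using hall
  exact ⟨∑ k, M k, ENNReal.sum_ne_top.2 fun k _ => hM k, fun μ h₁ h₂ k =>
    (hb k μ ⟨h₁, h₂⟩).trans (Finset.single_le_sum (fun _ _ => zero_le) (Finset.mem_univ k))⟩

lemma isClosed_interpolates {K I : ℕ} (t : Fin I → ℝ) (μbar : Fin I → Prob d) :
    IsClosed {μ : Fin (K + 1) → Prob d | Interpolates t μbar μ} := by
  have : {μ : Fin (K + 1) → Prob d | Interpolates t μbar μ} =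
      ⋂ (i : Fin I) (k : Fin (K + 1)) (_ : ((k : ℕ) : ℝ) = K * t i), {μ | μ k = μbar i} := by
    ext μ
    simp [Interpolates]
  rw [this]
  exact isClosed_iInter fun i => isClosed_iInter fun k => isClosed_iInter fun _ =>
    isClosed_eq (continuous_apply k) continuous_const

lemma continuous_displacement (c : ℝ) :
    Continuous fun p : Rd d × Rd d => (p.1, c • (p.2 - p.1)) := by
  fun_prop

/-- In the periodic case the witnessing plans are added as variables. They range over the compact
`optBall`, all conditions on them are closed, and projecting to the tuple preserves compactness. -/
lemma isCompact_holds_inter_tupleBall {K : ℕ} (hK : 2 ≤ K) (bc : BoundaryCondition d)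
    {M : ℝ≥0∞} (hM : M ≠ ⊤) :
    IsCompact ({μ : Fin (K + 1) → Prob d | bc.Holds hK μ} ∩ tupleBall d (K + 1) M) := by
  have hball := isCompact_tupleBall (d := d) (n := K + 1) hM
  cases bc with
  | natural => simpa [BoundaryCondition.Holds] using hball
  | cyclic => simpa [BoundaryCondition.Holds] using hball
  | hermite a₀ a₁ b₁ b₀ =>
    refine hball.inter_left ?_
    simp only [BoundaryCondition.Holds]
    exact (isClosed_eq (continuous_apply _) continuous_const).inter
      ((isClosed_eq (continuous_apply _) continuous_const).inter
        ((isClosed_eq (continuous_apply _) continuous_const).inter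
          (isClosed_eq (continuous_apply _) continuous_const)))
  | periodic ε =>
    let T : Set ((Fin (K + 1) → Prob d) × Plan d × Plan d) :=
      (tupleBall d (K + 1) M ×ˢ optBall d M ×ˢ optBall d M) ∩
      ({a | a.1 0 = a.1 (Fin.last K)} ∩ {a | push continuous_fst a.2.1 = a.1 0} ∩
        {a | push continuous_snd a.2.1 = a.1 ⟨1, by omega⟩} ∩
        {a | push continuous_fst a.2.2 = a.1 (Fin.last K)} ∩
        {a | push continuous_snd a.2.2 = a.1 ⟨K - 1, by omega⟩} ∩
        {a | push (continuous_displacement K) a.2.1 =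
          push (continuous_displacement (((ε : ℤ) : ℝ) * K)) a.2.2})
    have hT : IsCompact T := by
      refine (hball.prod ((isCompact_optBall hM).prod (isCompact_optBall hM))).inter_right ?_
      have hev : ∀ k : Fin (K + 1),
          Continuous fun a : (Fin (K + 1) → Prob d) × Plan d × Plan d => a.1 k := by fun_prop
      have h₁ : Continuous fun a : (Fin (K + 1) → Prob d) × Plan d × Plan d => a.2.1 := by fun_prop
      have h₂ : Continuous fun a : (Fin (K + 1) → Prob d) × Plan d × Plan d => a.2.2 := by fun_prop
      exact (((((isClosed_eq (hev _) (hev _)).inter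
        (isClosed_eq ((continuous_push _).comp h₁) (hev _))).inter
        (isClosed_eq ((continuous_push _).comp h₁) (hev _))).inter
        (isClosed_eq ((continuous_push _).comp h₂) (hev _))).inter
        (isClosed_eq ((continuous_push _).comp h₂) (hev _))).inter
        (isClosed_eq ((continuous_push _).comp h₁) ((continuous_push _).comp h₂))
    convert hT.image continuous_fst using 1
    ext μ
    constructor
    · rintro ⟨⟨h0, π, hπ, π', hπ', hd⟩, hμ⟩
      obtain ⟨hb, e₁, e₂⟩ := (mem_optBall_iff (hμ _) (hμ _)).1 hπ
      obtain ⟨hb', e₁', e₂'⟩ := (mem_optBall_iff (hμ _) (hμ _)).1 hπ'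
      exact ⟨(μ, π, π'), ⟨⟨hμ, hb, hb'⟩, ⟨⟨⟨⟨h0, e₁⟩, e₂⟩, e₁'⟩, e₂'⟩,
        ProbabilityMeasure.toMeasure_injective hd⟩, rfl⟩
    · rintro ⟨⟨μ, π, π'⟩, ⟨⟨hμ, hb, hb'⟩, ⟨⟨⟨⟨h0, e₁⟩, e₂⟩, e₁'⟩, e₂'⟩, hd⟩, rfl⟩
      exact ⟨⟨h0, π, (mem_optBall_iff (hμ _) (hμ _)).2 ⟨hb, e₁, e₂⟩, π',
        (mem_optBall_iff (hμ _) (hμ _)).2 ⟨hb', e₁', e₂'⟩,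
        congrArg ProbabilityMeasure.toMeasure hd⟩, hμ⟩

/-- Existence of discrete interpolations for an energy that is lower semicontinuous on sets of
bounded second moments, finite on measures with finite second moments, and controls consecutive
distances. -/
lemma exists_isDiscreteInterpolation {K I : ℕ} (hK : 2 ≤ K)
    (J : ∀ {n : ℕ}, (Fin (n + 1) → Prob d) → ℝ≥0∞)
    (hlsc : ∀ (n : ℕ) (M : ℝ≥0∞), M ≠ ⊤ →
      LowerSemicontinuousOn (J (n := n)) (tupleBall d (n + 1) M))
    (hfin : ∀ (n : ℕ) (μ : Fin (n + 1) → Prob d), (∀ k, μ k ∈ P2 d) → J μ ≠ ⊤)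
    {C : ℝ≥0∞} (hC : C ≠ ⊤)
    (hpath : ∀ (n : ℕ) (μ : Fin (n + 1) → Prob d) (k : Fin n),
      W2sq (μ k.castSucc) (μ k.succ) ≤ C * J μ)
    {t : Fin I → ℝ} {μbar : Fin I → Prob d} (bc : BoundaryCondition d)
    {i₀ : Fin I} (hi₀ : μbar i₀ ∈ P2 d) {k₀ : Fin (K + 1)} (hk₀ : ((k₀ : ℕ) : ℝ) = K * t i₀)
    (hne : ∃ ν ∈ Admissible hK t μbar bc, ∀ k, ν k ∈ P2 d) :
    ∃ μ : Fin (K + 1) → Prob d, IsDiscreteInterpolation hK J t μbar bc μ := by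
  -- The cyclic energy evaluates `J` on a tuple with one more entry, which is why `J` is given for
  -- all lengths.
  let snocFirst : (Fin (K + 1) → Prob d) → Fin (K + 1 + 1) → Prob d :=
    fun μ => Fin.snoc (α := fun _ => Prob d) μ (μ 0)
  have hsnoc_of : ∀ (S : Set (Prob d)) (μ : Fin (K + 1) → Prob d), (∀ k, μ k ∈ S) →
      ∀ k, snocFirst μ k ∈ S := by
    intro S μ hμ k
    refine Fin.lastCases ?_ (fun k => ?_) k
    · simpa [snocFirst] using hμ 0
    · simpa [snocFirst] using hμ k
  have hElsc : ∀ M : ℝ≥0∞, M ≠ ⊤ →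
      LowerSemicontinuousOn (fun μ => bc.energy J μ) (tupleBall d (K + 1) M) := by
    intro M hM
    cases bc with
    | cyclic =>
      exact lowerSemicontinuousOn_comp (hlsc (K + 1) M hM) (g := snocFirst)
        (Continuous.finSnoc (A := fun _ => Prob d) continuous_id (continuous_apply 0)) fun μ hμ => hsnoc_of (momentBall d M) μ hμ
    | natural => exact hlsc K M hM
    | hermite => exact hlsc K M hM
    | periodic => exact hlsc K M hM
  have hEfin : ∀ μ : Fin (K + 1) → Prob d, (∀ k, μ k ∈ P2 d) → bc.energy J μ ≠ ⊤ := by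
    intro μ hμ
    cases bc with
    | cyclic => exact hfin (K + 1) (snocFirst μ) (hsnoc_of (P2 d) μ hμ)
    | natural => exact hfin K μ hμ
    | hermite => exact hfin K μ hμ
    | periodic => exact hfin K μ hμ
  have hEpath : ∀ (μ : Fin (K + 1) → Prob d) (k : Fin K),
      W2sq (μ k.castSucc) (μ k.succ) ≤ C * bc.energy J μ := by
    intro μ k
    cases bc with
    | cyclic =>
      have h := hpath (K + 1) (snocFirst μ) k.castSucc
      rw [← Fin.castSucc_succ] at h
      simp only [snocFirst, Fin.snoc_castSucc] at h
      exact h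
    | natural => exact hpath K μ k
    | hermite => exact hpath K μ k
    | periodic => exact hpath K μ k
  obtain ⟨ν₀, hν₀, hν₀2⟩ := hne
  have hb := hEfin ν₀ hν₀2
  obtain ⟨M, hM, hbound⟩ := exists_moment_bound (d := d) k₀ (A := C * bc.energy J ν₀)
    (B := secondMoment (μbar i₀)) (ENNReal.mul_ne_top hC hb) (mem_P2_iff.1 hi₀).ne
  have hmem : ∀ μ ∈ Admissible hK t μbar bc, bc.energy J μ ≤ bc.energy J ν₀ →
      μ ∈ tupleBall d (K + 1) M := by
    intro μ hμ hle
    refine hbound μ (by rw [hμ.1 i₀ k₀ hk₀]) fun k => (hEpath μ k).trans ?_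
    gcongr
  have hcomp : IsCompact (Admissible hK t μbar bc ∩ tupleBall d (K + 1) M) := by
    have := (isCompact_holds_inter_tupleBall hK bc hM).inter_left
      (isClosed_interpolates (K := K) t μbar)
    rwa [← Set.inter_assoc] at this
  have hν₀mem : ν₀ ∈ Admissible hK t μbar bc ∩ tupleBall d (K + 1) M :=
    ⟨hν₀, hmem ν₀ hν₀ le_rfl⟩
  obtain ⟨μ, hμ, hmin⟩ := LowerSemicontinuousOn.exists_isMinOn ⟨ν₀, hν₀mem⟩ hcomp ((hElsc M hM).mono Set.inter_subset_right)
  have hμν₀ : bc.energy J μ ≤ bc.energy J ν₀ := hmin hν₀mem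
  refine ⟨μ, hμ.1, fun k => mem_P2_of_mem_momentBall hM (hμ.2 k), hμν₀.trans_lt hb.lt_top, ?_⟩
  intro ν hν
  -- Competitors no better than `ν₀` lose trivially; all others lie in the compact set.
  rcases le_total (bc.energy J ν) (bc.energy J ν₀) with h | h
  · exact hmin ⟨hν, hmem ν hν h⟩
  · exact hμν₀.trans h

/-- Free entries are filled with `μbar i₀`; injectivity of `t` rules out conflicting prescriptions.
-/
lemma exists_interpolates {K I : ℕ} (hK : K ≠ 0) {t : Fin I → ℝ} (ht : StrictMono t)
    {μbar : Fin I → Prob d} (hμbar : ∀ i, μbar i ∈ P2 d) (i₀ : Fin I) :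
    ∃ ν : Fin (K + 1) → Prob d, Interpolates t μbar ν ∧ ∀ k, ν k ∈ P2 d := by
  classical
  refine ⟨fun k => if h : ∃ i, ((k : ℕ) : ℝ) = K * t i then μbar h.choose else μbar i₀, ?_, ?_⟩
  · intro i k hk
    have h : ∃ i, ((k : ℕ) : ℝ) = K * t i := ⟨i, hk⟩
    simp only [dif_pos h]
    congr 1
    apply ht.injective
    exact mul_left_cancel₀ (Nat.cast_ne_zero.2 hK) (h.choose_spec.symm.trans hk)
  · intro k
    simp only
    split_ifs
    · exact hμbar _
    · exact hμbar _

lemma W2sq_le_of_path_le {δ : ℝ} (hδ : 0 < δ) {K : ℕ} (hK : K ≠ 0) {n : ℕ}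
    (μ : Fin (n + 1) → Prob d) {e : ℝ≥0∞} (he : ENNReal.ofReal δ * pathEnergy K μ ≤ e)
    (k : Fin n) : W2sq (μ k.castSucc) (μ k.succ) ≤ (ENNReal.ofReal δ * K)⁻¹ * e := by
  have h0 : ENNReal.ofReal δ * K ≠ 0 :=
    mul_ne_zero (ENNReal.ofReal_pos.2 hδ).ne' (Nat.cast_ne_zero.2 hK)
  have htop : ENNReal.ofReal δ * K ≠ ⊤ := ENNReal.mul_ne_top (by simp) (by simp)
  have h1 : ENNReal.ofReal δ * K * W2sq (μ k.castSucc) (μ k.succ) ≤ e := by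
    refine le_trans ?_ he
    rw [pathEnergy, mul_assoc]
    gcongr
    exact Finset.single_le_sum (f := fun k : Fin n => W2sq (μ k.castSucc) (μ k.succ))
      (fun _ _ => zero_le) (Finset.mem_univ k)
  calc W2sq (μ k.castSucc) (μ k.succ)
      = (ENNReal.ofReal δ * K)⁻¹ * (ENNReal.ofReal δ * K * W2sq (μ k.castSucc) (μ k.succ)) := by
        rw [← mul_assoc, ENNReal.inv_mul_cancel h0 htop, one_mul]
    _ ≤ _ := by gcongr

end Existence

end WassersteinSpline

/-! ### The theorem for both energies -/

open WassersteinSpline in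
theorem mainTheorem1 (d : ℕ) (δ : ℝ) (hδ : 0 < δ) (K I : ℕ) (hI : 2 ≤ I) (hIK : I ≤ K)
    (t : Fin I → ℝ) (ht01 : ∀ i, t i ∈ Set.Icc (0 : ℝ) 1) (htmono : StrictMono t)
    (htgrid : ∀ i, ∃ n : ℕ, (K : ℝ) * t i = n)
    (μbar : Fin I → Prob d) (hμbar : ∀ i, μbar i ∈ P2 d)
    (bc : BoundaryCondition d)
    (hbc : bc = .natural ∨ bc = .cyclic ∨
      ∃ ν ∈ Admissible (K := K) (hI.trans hIK) t μbar bc, ∀ k, ν k ∈ P2 d) :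
    (∃ μ : Fin (K + 1) → Prob d,
      IsDiscreteInterpolation (hI.trans hIK) (fun ν => regSplineEnergy δ K ν) t μbar bc μ) ∧
    (∃ μ : Fin (K + 1) → Prob d,
      IsDiscreteInterpolation (hI.trans hIK) (fun ν => regGenSplineEnergy δ K ν) t μbar bc μ) := by
  have hK : K ≠ 0 := by omega
  let i₀ : Fin I := ⟨0, by omega⟩
  obtain ⟨m, hm⟩ := htgrid i₀
  have hmK : m ≤ K := by
    have h : (m : ℝ) ≤ K := by
      rw [← hm]
      exact mul_le_of_le_one_right (Nat.cast_nonneg K) (ht01 i₀).2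
    exact_mod_cast h
  -- Natural and cyclic conditions do not restrict the tuple, so any interpolating tuple is a
  -- competitor of finite energy.
  have hne : ∃ ν ∈ Admissible (K := K) (hI.trans hIK) t μbar bc, ∀ k, ν k ∈ P2 d := by
    obtain ⟨ν, hν, hν2⟩ := exists_interpolates hK htmono hμbar i₀
    rcases hbc with rfl | rfl | h
    · exact ⟨ν, ⟨hν, trivial⟩, hν2⟩
    · exact ⟨ν, ⟨hν, trivial⟩, hν2⟩
    · exact h
  have hC : (ENNReal.ofReal δ * (K : ℝ≥0∞))⁻¹ ≠ ⊤ :=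
    ENNReal.inv_ne_top.2 (mul_ne_zero (ENNReal.ofReal_pos.2 hδ).ne' (Nat.cast_ne_zero.2 hK))
  have hk₀ : (((⟨m, by omega⟩ : Fin (K + 1)) : ℕ) : ℝ) = K * t i₀ := hm.symm
  constructor
  · refine exists_isDiscreteInterpolation _ (fun ν => regSplineEnergy δ K ν) (fun n M hM => ?_)
      (fun n μ hμ => ?_) hC (fun n μ k => ?_) bc (hμbar i₀) hk₀ hne
    · exact (lowerSemicontinuousOn_splineEnergy K n hM).add (lowerSemicontinuousOn_const_mul
        (lowerSemicontinuousOn_pathEnergy K n hM) ENNReal.ofReal_ne_top)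
    · exact ENNReal.add_ne_top.2 ⟨splineEnergy_ne_top K hμ,
        ENNReal.mul_ne_top ENNReal.ofReal_ne_top (pathEnergy_ne_top K hμ)⟩
    · exact W2sq_le_of_path_le hδ hK μ le_add_self k
  · refine exists_isDiscreteInterpolation _ (fun ν => regGenSplineEnergy δ K ν)
      (fun n M hM => ?_) (fun n μ hμ => ?_) hC (fun n μ k => ?_) bc (hμbar i₀) hk₀ hne
    · exact (lowerSemicontinuousOn_genSplineEnergy K n hM).add (lowerSemicontinuousOn_const_mul
        (lowerSemicontinuousOn_pathEnergy K n hM) ENNReal.ofReal_ne_top)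
    · exact ENNReal.add_ne_top.2 ⟨genSplineEnergy_ne_top K hμ,
        ENNReal.mul_ne_top ENNReal.ofReal_ne_top (pathEnergy_ne_top K hμ)⟩
    · exact W2sq_le_of_path_le hδ hK μ le_add_self k
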